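/- Let $\bar e_1,\dots,\bar e_8$ be the standard orthonormal basis of $\mathbb R^8$ and let $C\ell_8$ be the real Clifford algebra with $\bar e_B\bar e_C+\bar e_C\bar e_B=-2\delta_{BC}$. Put $$A_8=\mathrm{Re}\big[(\bar e_1+\sqrt{-1}\,\bar e_2)(\bar e_3+\sqrt{-1}\,\bar e_4)(\bar e_5+\sqrt{-1}\,\bar e_6)(\bar e_7+\sqrt{-1}\,\bar e_8)\big],\quad \beta_8=\bar e_1\bar e_3\bar e_5\bar e_7,\quad A=A_8(1+\beta_8),$$ and $\alpha_B=\bar e_1\bar e_BA$ for $B=1,\dots,8$. Let $G(2,8)$ be the Grassmann manifold of oriented $2$-planes in $\mathbb R^8$; a plane $x$ with oriented orthonormal basis $e_1,e_2$ is identified with $e_1\wedge e_2\in\bigwedge^2(\mathbb R^8)$ and with the Clifford product $e_1e_2\in C\ell_8$. Let $S^6=\{v\in\mathbb R^8 : |v|=1,\ v\perp\bar e_1\}$, with $T_vS^6=\{X\in\mathbb R^8 : X\perp \bar e_1,v\}$, the round metric, and the standard orientation (outward normal first in $\bar e_1^\perp$, which is oriented by $\bar e_2,\dots,\bar e_8$).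 An orthogonal complex structure on $T_vS^6$ is called oriented if it induces this orientation. For every $x\in G(2,8)$ there are exactly one real $8\times 8$ matrix $\Phi^*(x)$ and exactly one $\tau(x)\in S^6$ with $$x(\alpha_1,\dots,\alpha_8)=(\alpha_1,\dots,\alpha_8)\,\Phi^*(x),\qquad xA=\bar e_1\,\tau(x)\,A .$$ The matrix $\Phi^*(x)$ is regarded as a linear operator of $\mathbb R^8$. **Theorem 2.2.** The map $\tau: G(2,8)\to S^6$ is a smooth fibre bundle with fibre $\mathbb{CP}^3$. For each $v\in S^6$ and $x\in\tau^{-1}(v)$, the operator $\Phi^*(x)$ maps $T_vS^6$ into itself, and $x\mapsto \Phi^*(x)|_{T_vS^6}$ is a bijection from $\tau^{-1}(v)$ onto the set of oriented orthogonal complex structures on $T_vS^6$. Hence $G(2,8)$ is the twistor space of $S^6$: the map $x\mapsto(\tau(x),\Phi^*(x)|_{T_{\tau(x)}S^6})$ is a diffeomorphism from $G(2,8)$ onto the bundle over $S^6$ of all pairs $(v,j)$, where $v\in S^6$ and $j$ is an oriented orthogonal complex structure on $T_vS^6$. Moreover $f\mapsto J_f$, $J_f(v)=\Phi^*(f(v))|_{T_vS^6}$,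 is a bijection from the smooth sections $f:S^6\to G(2,8)$ of $\tau$ onto the smooth orthogonal almost complex structures on $S^6$ that induce its orientation; and for every smooth orthogonal almost complex structure $J$ on $S^6$, either $J$ or $-J$ induces the orientation. -/

import Mathlib

open scoped ContDiff InnerProductSpace TensorProduct

noncomputable section

namespace SixSphereTwistor

/-- Euclidean space `ℝ⁸`. -/
abbrev R8 : Type := EuclideanSpace ℝ (Fin 8)

/-- The fixed orthonormal basis, indexed from `0`: `ebar 0, …, ebar 7`. -/
def ebar (i : Fin 8) : R8 := EuclideanSpace.basisFun (Fin 8) ℝ i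

/-! ### The Clifford algebra and the spinor space -/

/-- The quadratic form `v ↦ -|v|²` on `ℝ⁸`. -/
def negSq : QuadraticForm ℝ R8 := -(LinearMap.BilinMap.toQuadraticMap (innerₗ R8))

/-- The Clifford algebra of `ℝ⁸` in which `v * v = -|v|²`. -/
abbrev Cl8 : Type := CliffordAlgebra negSq

/-- A vector of `ℝ⁸` as an element of the Clifford algebra. -/
def vec (v : R8) : Cl8 := CliffordAlgebra.ι negSq v

/-- The real part `ℂ ⊗ Cl8 → Cl8` of an element of the complexified Clifford algebra. -/
def cliffordRe : ℂ ⊗[ℝ] Cl8 →ₗ[ℝ] Cl8 :=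
  (TensorProduct.lid ℝ Cl8).toLinearMap ∘ₗ LinearMap.rTensor Cl8 Complex.reLm

/-- `isotropic a b = a + √-1 b` in the complexified Clifford algebra. -/
def isotropic (a b : R8) : ℂ ⊗[ℝ] Cl8 := 1 ⊗ₜ[ℝ] vec a + Complex.I ⊗ₜ[ℝ] vec b

/-- The element `Re[(e₁ + √-1 e₂)(e₃ + √-1 e₄)(e₅ + √-1 e₆)(e₇ + √-1 e₈)]`. -/
def spinorA8 : Cl8 :=
  cliffordRe (isotropic (ebar 0) (ebar 1) * isotropic (ebar 2) (ebar 3) *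
    isotropic (ebar 4) (ebar 5) * isotropic (ebar 6) (ebar 7))

/-- The element `e₁ e₃ e₅ e₇`. -/
def beta8 : Cl8 := vec (ebar 0) * vec (ebar 2) * vec (ebar 4) * vec (ebar 6)

/-- The generator `A = A₈ (1 + β₈)` of the spinor module `Cl8 * A`. -/
def spinorA : Cl8 := spinorA8 * (1 + beta8)

/-- The basis `α_B = e₁ e_B A` of the positive spinors (again indexed from `0`). -/
def posSpinor (B : Fin 8) : Cl8 := vec (ebar 0) * vec (ebar B) * spinorA

/-! ### The Grassmann manifold of oriented planes -/

/-- The bivector `a ∧ b`, as the skew-symmetric operator `w ↦ ⟪a, w⟫ b - ⟪b, w⟫ a`, under the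
standard identification of `Λ²(ℝ⁸)` with the skew-symmetric operators of `ℝ⁸`. -/
def wedge (a b : R8) : R8 →L[ℝ] R8 :=
  (innerSL ℝ a).smulRight b - (innerSL ℝ b).smulRight a

/-- The Grassmann manifold `G(2,8)` of oriented planes in `ℝ⁸`: the plane with oriented orthonormal
basis `a, b` is the bivector `a ∧ b`. It is an embedded submanifold of the space of bivectors, so
that smoothness of maps from and into it can be expressed in that vector space. -/
def G28 : Set (R8 →L[ℝ] R8) :=
  {x | ∃ a b : R8, Orthonormal ℝ ![a, b] ∧ x = wedge a b}

/-- The linear inclusion of the bivectors in the Clifford algebra. By `toCl_wedge` it sends the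
oriented plane with oriented orthonormal basis `a, b` to the Clifford product `a b`. -/
def toCl (x : R8 →L[ℝ] R8) : Cl8 := (1 / 2 : ℝ) • ∑ i, vec (ebar i) * vec (x (ebar i))

lemma vec_mul_add (a b : R8) :
    vec a * vec b + vec b * vec a = algebraMap ℝ Cl8 (-2 * ⟪a, b⟫_ℝ) := by
  unfold vec
  rw [CliffordAlgebra.ι_mul_ι_add_swap]
  congr 1
  simp only [QuadraticMap.polar, negSq, neg_apply,
    LinearMap.BilinMap.toQuadraticMap_apply, innerₗ_apply_apply, inner_add_left, inner_add_right,
    real_inner_comm a b]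
  ring

lemma sum_inner_vec (a : R8) : ∑ i, ⟪a, ebar i⟫_ℝ • vec (ebar i) = vec a := by
  have h := (EuclideanSpace.basisFun (Fin 8) ℝ).sum_repr' a
  unfold vec ebar
  conv_rhs => rw [← h]
  rw [map_sum]
  refine Finset.sum_congr rfl fun i _ => ?_
  rw [map_smul, real_inner_comm]

lemma toCl_wedge {a b : R8} (h : Orthonormal ℝ ![a, b]) :
    toCl (wedge a b) = vec a * vec b := by
  have hab : ⟪a, b⟫_ℝ = 0 := by simpa using h.2 (show (0 : Fin 2) ≠ 1 by decide)
  have h1 : ∀ i, vec (ebar i) * vec (wedge a b (ebar i)) =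
      (⟪a, ebar i⟫_ℝ • vec (ebar i)) * vec b - (⟪b, ebar i⟫_ℝ • vec (ebar i)) * vec a := by
    intro i
    simp [wedge, vec, mul_sub]
  have h2 : vec b * vec a = - (vec a * vec b) := by
    have := vec_mul_add a b
    rw [hab, mul_zero, map_zero] at this
    exact eq_neg_of_add_eq_zero_right this
  unfold toCl
  rw [Finset.sum_congr rfl fun i _ => h1 i, Finset.sum_sub_distrib, ← Finset.sum_mul,
    ← Finset.sum_mul, sum_inner_vec, sum_inner_vec, h2, sub_neg_eq_add, ← two_smul ℝ, smul_smul]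
  norm_num

/-! ### The map `τ` and the spin representation -/

/-- The sphere `S⁶` of unit vectors orthogonal to `e₁`. -/
def S6 : Set R8 := {v | ‖v‖ = 1 ∧ ⟪ebar 0, v⟫_ℝ = 0}

/-- `τ x` is the point `v` of `S⁶` with `x A = e₁ v A`. -/
def tau (x : R8 →L[ℝ] R8) : R8 :=
  Classical.epsilon fun v => v ∈ S6 ∧ toCl x * spinorA = vec (ebar 0) * vec v * spinorA

/-- `B` is the matrix of left Clifford multiplication by `x` on the positive spinors:
`x (α₁, …, α₈) = (α₁, …, α₈) B`. -/
def IsSpinMatrix (x : R8 →L[ℝ] R8) (B : Matrix (Fin 8) (Fin 8) ℝ) : Prop :=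
  ∀ j, toCl x * posSpinor j = ∑ i, B i j • posSpinor i

/-- The matrix `Φ^*(x)`. -/
def spinMatrix (x : R8 →L[ℝ] R8) : Matrix (Fin 8) (Fin 8) ℝ :=
  Classical.epsilon (IsSpinMatrix x)

/-- The operator `J_x` of `ℝ⁸` whose matrix is `Φ^*(x)`. -/
def spinOp (x : R8 →L[ℝ] R8) : R8 →L[ℝ] R8 := Matrix.toEuclideanCLM (𝕜 := ℝ) (spinMatrix x)

/-! ### Orthogonal complex structures on the tangent spaces of `S⁶` -/

/-- The tangent space `T_v S⁶`, the orthogonal complement of `e₁` and `v`. -/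
abbrev tangent (v : R8) : Submodule ℝ R8 := (Submodule.span ℝ {ebar 0, v})ᗮ

/-- Orthogonal complex structures on a subspace `T` of `ℝ⁸`. -/
def IsOrthogonalComplexStructure {T : Submodule ℝ R8} (j : T →L[ℝ] T) : Prop :=
  (∀ w, j (j w) = -w) ∧ ∀ w w', ⟪j w, j w'⟫_ℝ = ⟪w, w'⟫_ℝ

/-- The complex structure `j` induces on `T_v S⁶` the standard orientation of `S⁶` (outward normal
first in the space orthogonal to `e₁`, which is oriented by `e₂, …, e₈`): every basis
`w₀, j w₀, w₁, j w₁, w₂, j w₂` of `T_v S⁶` is positively oriented. -/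
def InducesOrientation {v : R8} (j : tangent v →L[ℝ] tangent v) : Prop :=
  ∀ w : Fin 3 → tangent v,
    LinearIndependent ℝ ![w 0, j (w 0), w 1, j (w 1), w 2, j (w 2)] →
    0 < (EuclideanSpace.basisFun (Fin 8) ℝ).toBasis.det
      ![ebar 0, v, (w 0 : R8), (j (w 0) : R8), (w 1 : R8), (j (w 1) : R8), (w 2 : R8),
        (j (w 2) : R8)]

/-- The oriented orthogonal complex structures on `T_v S⁶`. -/
def complexStructures (v : R8) : Set (tangent v →L[ℝ] tangent v) :=
  {j | IsOrthogonalComplexStructure j ∧ InducesOrientation j}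

/-- The operator of `T_v S⁶` that an operator of `ℝ⁸` induces: its restriction, if it maps `T_v S⁶`
into itself. -/
def onTangent (v : R8) (J : R8 →L[ℝ] R8) : tangent v →L[ℝ] tangent v :=
  (tangent v).orthogonalProjectionOnto ∘L J ∘L (tangent v).subtypeL

/-- The extension of an operator of `T_v S⁶` to `ℝ⁸` by zero on the orthogonal complement. -/
def extend {v : R8} (j : tangent v →L[ℝ] tangent v) : R8 →L[ℝ] R8 :=
  (tangent v).subtypeL ∘L j ∘L (tangent v).orthogonalProjectionOnto

/-- The twistor space of `S⁶`: the pairs of a point `v` of `S⁶` and an oriented orthogonal complex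
structure on `T_v S⁶`, with its smooth structure as a submanifold of `ℝ⁸ × End(ℝ⁸)`. -/
def twistorSpace : Set (R8 × (R8 →L[ℝ] R8)) :=
  {p | p.1 ∈ S6 ∧ ∃ j ∈ complexStructures p.1, p.2 = extend j}

/-- A smooth almost complex structure on `S⁶` that is orthogonal for the round metric. Only the
values `J v` for `v` in `S⁶` matter. -/
def IsAlmostComplexStructure (J : ∀ v : R8, tangent v →L[ℝ] tangent v) : Prop :=
  ContDiffOn ℝ ∞ (fun v => extend (J v)) S6 ∧ ∀ v ∈ S6, IsOrthogonalComplexStructure (J v)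

/-- `f` is a smooth section of `τ` over `S⁶`. Only the values on `S⁶` matter. -/
def IsSection (f : R8 → (R8 →L[ℝ] R8)) : Prop :=
  ContDiffOn ℝ ∞ f S6 ∧ ∀ v ∈ S6, f v ∈ G28 ∧ tau (f v) = v

/-- The field of operators on the tangent spaces of `S⁶` that is defined by `f`. -/
def inducedStructure (f : R8 → (R8 →L[ℝ] R8)) (v : R8) : tangent v →L[ℝ] tangent v :=
  onTangent v (spinOp (f v))

/-! ### Smooth fibre bundles -/

/-- Complex projective space `CP³`, as a submanifold of a vector space: a line is identified with
the orthogonal projection onto it. -/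
def CP3 : Set (EuclideanSpace ℂ (Fin 4) →L[ℂ] EuclideanSpace ℂ (Fin 4)) :=
  Set.range fun L : Projectivization ℂ (EuclideanSpace ℂ (Fin 4)) => L.submodule.starProjection

/-- `e` is a diffeomorphism from `S` onto `S'`, for embedded submanifolds `S` and `S'` of vector
spaces. (On such sets `ContDiffOn` is smoothness of maps between manifolds.) -/
def IsDiffeomorphism {V W : Type*} [NormedAddCommGroup V] [NormedSpace ℝ V]
    [NormedAddCommGroup W] [NormedSpace ℝ W] (e : PartialEquiv V W) (S : Set V) (S' : Set W) :
    Prop :=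
  e.source = S ∧ e.target = S' ∧ ContDiffOn ℝ ∞ e S ∧ ContDiffOn ℝ ∞ e.symm S'

/-- `p` is the projection of a smooth fibre bundle with total space `P`, base `M` and fibre `F`. -/
def IsSmoothFibreBundle {V W U : Type*} [NormedAddCommGroup V] [NormedSpace ℝ V]
    [NormedAddCommGroup W] [NormedSpace ℝ W] [NormedAddCommGroup U] [NormedSpace ℝ U]
    (p : V → W) (P : Set V) (M : Set W) (F : Set U) : Prop :=
  Set.MapsTo p P M ∧ ContDiffOn ℝ ∞ p P ∧
    ∀ m ∈ M, ∃ O : Set W, IsOpen O ∧ m ∈ O ∧ ∃ h : PartialEquiv V (W × U),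
      IsDiffeomorphism h (P ∩ p ⁻¹' O) ((M ∩ O) ×ˢ F) ∧ ∀ x ∈ P ∩ p ⁻¹' O, (h x).1 = p x

end SixSphereTwistor

end

open SixSphereTwistor

noncomputable section

namespace SixSphereTwistor

/-! ### The octonionic product on `ℝ⁸` -/

/-! The left module generated by `spinorA` contains two copies of `ℝ⁸`: the positive spinors `e₁ w
A` and the negative spinors `w A`. In these coordinates Clifford multiplication by a vector is an
octonion-type product `cross` with `|cross a v| = |a| |v|` (`inner_cross_self`,
`vec_mul_vec_mul_spinorA`). Since `A ≠ 0`, the coordinates are unique. Hence `Φ^*(x)` is the matrix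
of an operator `spinLin x` that is linear in `x`, and `τ x = -spinLin x (ebar 0)`. For a plane `x`
this operator is an orthogonal complex structure of `ℝ⁸`. It rotates the plane of `ebar 0` and `τ
x`, and therefore preserves the orthogonal complement `tangent (τ x)`.

Fibres: right multiplication by `v` in `S⁶` gives a complex structure `cplx v` on `ℝ⁸`, and `τ (a ∧
b) = v` means `b = cplx v a` (`mem_fibre_iff`). So the fibre consists of the complex lines of `(ℝ⁸,
cplx v) ≅ ℂ⁴`, which is `CP³`. Away from the antipode of `m`, the operator `1 - cplx m ∘ cplx v` is
a multiple of an isometry that intertwines `cplx v` and `cplx m`; conjugation with it trivializes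
`τ`.

Complex structures: triality gives a linear left inverse `spinInv` of `spinLin` on planes, so `x` is
recovered smoothly from `τ x` and the restricted operator (`eq_spinInv`). For surjectivity, two
commuting involutions built from Clifford products have a common fixed vector, which yields a plane
in the fibre with prescribed values on two complex lines of `tangent v` (`exists_plane_of_pairs`).
Orthogonality fixes the value on the third line up to sign, and the orientation decides the sign,
because the operators of all planes are conjugate by maps of positive determinant
(`positivelyConjugate_cross`).

Consequently `j` or `-j` comes from a plane, for every orthogonal `j`. Planes form a compact set, so
inducing the orientation is a closed condition along a smooth `J`, and the connectedness of `S⁶`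
gives the last claim. -/

/-- The bilinear product with `e₁ a e₁ v A = e₁ (cross a v) A`, in coordinates. -/
def crossFun (a v : R8) : R8 := !₂[
  - a 0 * v 0 + a 1 * v 1 + a 2 * v 2 + a 3 * v 3 + a 4 * v 4 + a 5 * v 5 + a 6 * v 6 + a 7 * v 7,
  - a 0 * v 1 - a 1 * v 0 + a 2 * v 3 - a 3 * v 2 + a 4 * v 5 - a 5 * v 4 + a 6 * v 7 - a 7 * v 6,
  - a 0 * v 2 - a 1 * v 3 - a 2 * v 0 + a 3 * v 1 - a 4 * v 6 + a 5 * v 7 + a 6 * v 4 - a 7 * v 5,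
  - a 0 * v 3 + a 1 * v 2 - a 2 * v 1 - a 3 * v 0 + a 4 * v 7 + a 5 * v 6 - a 6 * v 5 - a 7 * v 4,
  - a 0 * v 4 - a 1 * v 5 + a 2 * v 6 - a 3 * v 7 - a 4 * v 0 + a 5 * v 1 - a 6 * v 2 + a 7 * v 3,
  - a 0 * v 5 + a 1 * v 4 - a 2 * v 7 - a 3 * v 6 - a 4 * v 1 - a 5 * v 0 + a 6 * v 3 + a 7 * v 2,
  - a 0 * v 6 - a 1 * v 7 - a 2 * v 4 + a 3 * v 5 + a 4 * v 2 - a 5 * v 3 - a 6 * v 0 + a 7 * v 1,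
  - a 0 * v 7 + a 1 * v 6 + a 2 * v 5 + a 3 * v 4 - a 4 * v 3 - a 5 * v 2 - a 6 * v 1 - a 7 * v 0]

lemma crossFun_add_left (a a' v : R8) : crossFun (a + a') v = crossFun a v + crossFun a' v := by
  ext i; fin_cases i <;> simp [crossFun] <;> ring

lemma crossFun_smul_left (c : ℝ) (a v : R8) : crossFun (c • a) v = c • crossFun a v := by
  ext i; fin_cases i <;> simp [crossFun] <;> ring

lemma crossFun_add_right (a v v' : R8) : crossFun a (v + v') = crossFun a v + crossFun a v' := by
  ext i; fin_cases i <;> simp [crossFun] <;> ring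

lemma crossFun_smul_right (c : ℝ) (a v : R8) : crossFun a (c • v) = c • crossFun a v := by
  ext i; fin_cases i <;> simp [crossFun] <;> ring

/-- The product `crossFun` as a continuous bilinear map. -/
def cross : R8 →L[ℝ] R8 →L[ℝ] R8 :=
  LinearMap.toContinuousLinearMap ((LinearMap.toContinuousLinearMap (𝕜 := ℝ)
    (E := R8) (F' := R8)).toLinearMap ∘ₗ
    LinearMap.mk₂ ℝ crossFun crossFun_add_left crossFun_smul_left crossFun_add_right
      crossFun_smul_right)

lemma cross_apply (a v : R8) : cross a v = crossFun a v := rfl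

lemma inner_eq_sum (v w : R8) : ⟪v, w⟫_ℝ = v 0 * w 0 + v 1 * w 1 + v 2 * w 2 + v 3 * w 3 +
    v 4 * w 4 + v 5 * w 5 + v 6 * w 6 + v 7 * w 7 := by
  simp [PiLp.inner_apply, Fin.sum_univ_eight, mul_comm]

/-- This is an eight-square identity. All further properties of `cross` follow from it by
polarization and by inserting `ebar 0`, on which the product is `-1`. -/
lemma inner_cross_self (a v : R8) :
    ⟪cross a v, cross a v⟫_ℝ = ⟪a, a⟫_ℝ * ⟪v, v⟫_ℝ := by
  simp only [cross_apply, inner_eq_sum]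
  simp [crossFun]
  ring

lemma cross_ebar_zero_left (v : R8) : cross (ebar 0) v = -v := by
  ext i; fin_cases i <;> simp [cross_apply, crossFun, ebar]

lemma cross_ebar_zero_right (a : R8) : cross a (ebar 0) = -a := by
  ext i; fin_cases i <;> simp [cross_apply, crossFun, ebar]

lemma inner_cross_left (a v w : R8) :
    ⟪cross a v, cross a w⟫_ℝ = ⟪a, a⟫_ℝ * ⟪v, w⟫_ℝ := by
  have h1 := inner_cross_self a (v + w)
  have h2 := inner_cross_self a v
  have h3 := inner_cross_self a w
  simp only [map_add, inner_add_left, inner_add_right] at h1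
  rw [real_inner_comm v w, real_inner_comm (cross a v) (cross a w)] at h1
  linarith

lemma inner_cross_right (a b v : R8) :
    ⟪cross a v, cross b v⟫_ℝ = ⟪a, b⟫_ℝ * ⟪v, v⟫_ℝ := by
  have h1 := inner_cross_self (a + b) v
  have h2 := inner_cross_self a v
  have h3 := inner_cross_self b v
  simp only [map_add, add_apply, inner_add_left, inner_add_right] at h1
  rw [real_inner_comm a b, real_inner_comm (cross a v) (cross b v)] at h1
  linarith

lemma inner_cross_add (a b v w : R8) :
    ⟪cross a v, cross b w⟫_ℝ + ⟪cross b v, cross a w⟫_ℝ = 2 * ⟪a, b⟫_ℝ * ⟪v, w⟫_ℝ := by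
  have h1 := inner_cross_left (a + b) v w
  have h2 := inner_cross_left a v w
  have h3 := inner_cross_left b v w
  simp only [map_add, add_apply, inner_add_left, inner_add_right] at h1
  rw [real_inner_comm a b] at h1
  linarith

lemma inner_cross_add' (a b v w : R8) :
    ⟪cross a v, cross b w⟫_ℝ + ⟪cross a w, cross b v⟫_ℝ = 2 * ⟪a, b⟫_ℝ * ⟪v, w⟫_ℝ := by
  have h1 := inner_cross_right a b (v + w)
  have h2 := inner_cross_right a b v
  have h3 := inner_cross_right a b w
  simp only [map_add, inner_add_left, inner_add_right] at h1
  rw [real_inner_comm v w] at h1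
  linarith

/-- The adjoint of `cross a`. -/
lemma inner_cross_swap (a v w : R8) :
    ⟪cross a v, w⟫_ℝ = -⟪v, cross a w⟫_ℝ - 2 * ⟪a, ebar 0⟫_ℝ * ⟪v, w⟫_ℝ := by
  -- As `cross (ebar 0)` is `-1`, the polarized norm identity with second vector `ebar 0` is already
  -- the formula for the adjoint.
  have := inner_cross_add a (ebar 0) v w
  simp only [cross_ebar_zero_left, inner_neg_left, inner_neg_right] at this
  linarith

/-- `-cross · v` is skew-symmetric up to the component of `v` along `e₁`. -/
lemma inner_cross_swap' (a b v : R8) :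
    ⟪cross a v, b⟫_ℝ = -⟪a, cross b v⟫_ℝ - 2 * ⟪a, b⟫_ℝ * ⟪ebar 0, v⟫_ℝ := by
  have := inner_cross_add' a b v (ebar 0)
  simp only [cross_ebar_zero_right, inner_neg_left, inner_neg_right] at this
  rw [real_inner_comm (ebar 0) v] at this
  linarith

lemma norm_cross (a v : R8) : ‖cross a v‖ = ‖a‖ * ‖v‖ := by
  have := inner_cross_self a v
  simp only [real_inner_self_eq_norm_sq, ← mul_pow] at this
  exact (sq_eq_sq₀ (norm_nonneg _) (by positivity)).1 this

lemma norm_ebar (i : Fin 8) : ‖ebar i‖ = 1 := by simp [ebar]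

lemma inner_ebar_ebar (i j : Fin 8) : ⟪ebar i, ebar j⟫_ℝ = if i = j then 1 else 0 :=
  orthonormal_iff_ite.1 (EuclideanSpace.basisFun (Fin 8) ℝ).orthonormal i j

lemma ebar_zero_inner_self : ⟪ebar 0, ebar 0⟫_ℝ = 1 := by
  rw [inner_ebar_ebar, if_pos rfl]

/-! ### Left Clifford multiplication by even elements on the positive spinors -/

/-- The operator of `a b` on the positive spinors. -/
def spinPair (a b : R8) : R8 →L[ℝ] R8 :=
  (cross a + (2 * ⟪a, ebar 0⟫_ℝ) • ContinuousLinearMap.id ℝ R8) ∘L cross b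

lemma spinPair_apply (a b w : R8) :
    spinPair a b w = cross a (cross b w) + (2 * ⟪a, ebar 0⟫_ℝ) • cross b w := by
  simp [spinPair]

lemma inner_spinPair (a b w u : R8) :
    ⟪spinPair a b w, u⟫_ℝ = -⟪cross b w, cross a u⟫_ℝ := by
  rw [spinPair_apply, inner_add_left, inner_cross_swap, inner_smul_left]
  simp

lemma spinPair_add_swap (a b w : R8) :
    spinPair a b w + spinPair b a w = (-2 * ⟪a, b⟫_ℝ) • w := by
  refine ext_inner_right ℝ fun u => ?_
  rw [inner_add_left, inner_spinPair, inner_spinPair, inner_smul_left]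
  have := inner_cross_add a b w u
  simp only [conj_trivial]
  linarith

lemma spinPair_self (a w : R8) : spinPair a a w = -⟪a, a⟫_ℝ • w := by
  refine ext_inner_right ℝ fun u => ?_
  rw [inner_spinPair, inner_cross_left, inner_smul_left]
  simp

/-- `cross a` composed with its adjoint. -/
lemma cross_adjoint_cross (a b w : R8) (hab : ⟪a, a⟫_ℝ = 1) :
    cross a (spinPair a b w) = -cross b w := by
  have h1 : ∀ z, cross a (cross a z) + (2 * ⟪a, ebar 0⟫_ℝ) • cross a z = -z := by
    intro z
    have := spinPair_self a z
    rw [spinPair_apply, hab, neg_one_smul] at this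
    exact this
  rw [spinPair_apply, map_add, map_smul]
  exact h1 _

/-- This is the relation `b b = -|b|²` inside the product `a b b c`. -/
lemma spinPair_comp (a b c w : R8) :
    spinPair a b (spinPair b c w) = -⟪b, b⟫_ℝ • spinPair a c w := by
  have h1 : ∀ z, cross b (cross b z) + (2 * ⟪b, ebar 0⟫_ℝ) • cross b z = -⟪b, b⟫_ℝ • z := by
    intro z
    have := spinPair_self b z
    rwa [spinPair_apply] at this
  have h2 : cross b (spinPair b c w) = -⟪b, b⟫_ℝ • cross c w := by
    rw [spinPair_apply, map_add, map_smul, h1]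
  rw [spinPair_apply, h2, spinPair_apply, map_smul]
  module

/-- The operator of a bivector on the positive spinors. -/
def spinLin : (R8 →L[ℝ] R8) →ₗ[ℝ] (R8 →L[ℝ] R8) where
  toFun x := (1 / 2 : ℝ) • ∑ i, spinPair (ebar i) (x (ebar i))
  map_add' x y := by
    refine ContinuousLinearMap.ext fun w => ?_
    simp only [add_apply, smul_apply, sum_apply, spinPair_apply, map_add, smul_add,
      Finset.sum_add_distrib]
    abel
  map_smul' c x := by
    refine ContinuousLinearMap.ext fun w => ?_
    simp only [smul_apply, sum_apply, spinPair_apply, map_smul, RingHom.id_apply]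
    rw [smul_comm, Finset.smul_sum (r := c)]
    congr 1
    refine Finset.sum_congr rfl fun i _ => ?_
    module

lemma spinLin_apply (x : R8 →L[ℝ] R8) (w : R8) :
    spinLin x w = (1 / 2 : ℝ) • ∑ i, spinPair (ebar i) (x (ebar i)) w := by
  simp [spinLin]

lemma sum_inner_ebar_smul (a : R8) : ∑ i, ⟪a, ebar i⟫_ℝ • ebar i = a := by
  conv_rhs => rw [← (EuclideanSpace.basisFun (Fin 8) ℝ).sum_repr' a]
  refine Finset.sum_congr rfl fun i _ => ?_
  rw [real_inner_comm]; rfl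

/-- `spinPair` as a bilinear map. -/
lemma sum_spinPair_left (a b w : R8) :
    ∑ i, ⟪a, ebar i⟫_ℝ • spinPair (ebar i) b w = spinPair a b w := by
  conv_rhs => rw [← sum_inner_ebar_smul a]
  simp only [spinPair_apply, map_sum, map_smul, sum_apply, smul_apply, sum_inner, inner_smul_left,
    conj_trivial, Finset.mul_sum, Finset.sum_smul, ← Finset.sum_add_distrib, smul_add, smul_smul]
  refine Finset.sum_congr rfl fun i _ => ?_
  congr 2
  ring

/-- For orthogonal vectors `spinPair` is antisymmetric, so the two halves of the sum agree and
absorb the factor `1 / 2`. -/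
lemma spinLin_wedge (a b w : R8) (hab : ⟪a, b⟫_ℝ = 0) :
    spinLin (wedge a b) w = spinPair a b w := by
  have h1 : ∀ i, spinPair (ebar i) (wedge a b (ebar i)) w =
      ⟪a, ebar i⟫_ℝ • spinPair (ebar i) b w - ⟪b, ebar i⟫_ℝ • spinPair (ebar i) a w := by
    intro i
    simp only [wedge, spinPair_apply, sub_apply, map_sub, map_smul, smul_apply,
      ContinuousLinearMap.smulRight_apply, innerSL_apply_apply]
    module
  have h2 := spinPair_add_swap a b w
  rw [hab, mul_zero, zero_smul] at h2
  rw [spinLin_apply, Finset.sum_congr rfl fun i _ => h1 i, Finset.sum_sub_distrib,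
    sum_spinPair_left, sum_spinPair_left, eq_neg_of_add_eq_zero_right h2]
  module

/-! ### The stabilizer of the spinor `A` -/

/-- Sorting two of the Clifford generators. -/
lemma vec_ebar_swap {i j : Fin 8} (h : i < j) :
    vec (ebar j) * vec (ebar i) = -(vec (ebar i) * vec (ebar j)) := by
  have := vec_mul_add (ebar j) (ebar i)
  rw [inner_ebar_ebar, if_neg h.ne', mul_zero, map_zero] at this
  exact eq_neg_of_add_eq_zero_left this

lemma vec_ebar_swap_assoc {i j : Fin 8} (h : i < j) (x : Cl8) :
    vec (ebar j) * (vec (ebar i) * x) = -(vec (ebar i) * (vec (ebar j) * x)) := by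
  rw [← mul_assoc, vec_ebar_swap h, neg_mul, mul_assoc]

lemma vec_mul_self (a : R8) : vec a * vec a = algebraMap ℝ Cl8 (-⟪a, a⟫_ℝ) := by
  have h : negSq a = -⟪a, a⟫_ℝ := by
    simp only [negSq, neg_apply, LinearMap.BilinMap.toQuadraticMap_apply, innerₗ_apply_apply]
  rw [vec, CliffordAlgebra.ι_sq_scalar, h]

lemma vec_ebar_sq (i : Fin 8) : vec (ebar i) * vec (ebar i) = -1 := by
  rw [vec_mul_self, inner_ebar_ebar, if_pos rfl, map_neg, map_one]

lemma vec_ebar_sq_assoc (i : Fin 8) (x : Cl8) :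
    vec (ebar i) * (vec (ebar i) * x) = -x := by
  rw [← mul_assoc, vec_ebar_sq, neg_one_mul]

lemma cliffordRe_tmul (z : ℂ) (x : Cl8) : cliffordRe (z ⊗ₜ[ℝ] x) = z.re • x := by
  simp [cliffordRe]

lemma spinorA8_eq : spinorA8 =
    vec (ebar 0) * (vec (ebar 2) * (vec (ebar 4) * vec (ebar 6))) -
    vec (ebar 0) * (vec (ebar 2) * (vec (ebar 5) * vec (ebar 7))) -
    vec (ebar 0) * (vec (ebar 3) * (vec (ebar 4) * vec (ebar 7))) -
    vec (ebar 0) * (vec (ebar 3) * (vec (ebar 5) * vec (ebar 6))) -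
    vec (ebar 1) * (vec (ebar 2) * (vec (ebar 4) * vec (ebar 7))) -
    vec (ebar 1) * (vec (ebar 2) * (vec (ebar 5) * vec (ebar 6))) -
    vec (ebar 1) * (vec (ebar 3) * (vec (ebar 4) * vec (ebar 6))) +
    vec (ebar 1) * (vec (ebar 3) * (vec (ebar 5) * vec (ebar 7))) := by
  simp only [spinorA8, isotropic, add_mul, mul_add, Algebra.TensorProduct.tmul_mul_tmul, map_add,
    cliffordRe_tmul, one_mul, mul_one, mul_assoc, Complex.I_mul_I, Complex.mul_re, Complex.I_re,
    Complex.I_im, Complex.one_re, Complex.neg_re, Complex.neg_im, Complex.one_im, mul_neg, neg_zero,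
    mul_zero, one_smul, zero_smul, neg_smul, sub_zero, add_zero, neg_neg]
  abel

/-- In the complexified algebra `a b (a + √-1 b) = -√-1 (a + √-1 b)` for orthonormal `a, b`, and the
even element `a b` commutes with the other isotropic factors. Two such pairs act by `(-√-1)² = -1`.
-/
lemma volume_mul_spinorA8 (i j k l : Fin 8)
    (h : (i, j, k, l) = (0, 1, 2, 3) ∨ (i, j, k, l) = (0, 1, 4, 5) ∨ (i, j, k, l) = (0, 1, 6, 7)) :
    vec (ebar i) * (vec (ebar j) * (vec (ebar k) * (vec (ebar l) * spinorA8))) = -spinorA8 := by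
  rw [spinorA8_eq]
  rcases h with h | h | h <;> cases h <;>
  · simp only [mul_add, mul_sub]
    simp (discharger := decide) only [vec_ebar_swap, vec_ebar_swap_assoc, vec_ebar_sq,
      vec_ebar_sq_assoc, mul_neg, neg_neg, mul_one]
    abel

lemma beta8_mul_self : beta8 * beta8 = 1 := by
  simp (discharger := decide) only [beta8, mul_assoc, vec_ebar_swap_assoc, vec_ebar_sq,
      vec_ebar_sq_assoc, mul_neg, neg_neg]

lemma beta8_mul_spinorA8 : beta8 * spinorA8 = spinorA8 * beta8 := by
  rw [spinorA8_eq, beta8]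
  simp only [mul_add, mul_sub, add_mul, sub_mul, mul_assoc]
  simp (discharger := decide) only [vec_ebar_swap, vec_ebar_swap_assoc, vec_ebar_sq,
      vec_ebar_sq_assoc, mul_neg, neg_neg, mul_one]

lemma beta8_mul_spinorA : beta8 * spinorA = spinorA := by
  rw [spinorA, ← mul_assoc, beta8_mul_spinorA8, mul_assoc, mul_add, mul_one, beta8_mul_self,
    add_comm]

lemma volume_mul_spinorA (i j k l : Fin 8)
    (h : (i, j, k, l) = (0, 1, 2, 3) ∨ (i, j, k, l) = (0, 1, 4, 5) ∨ (i, j, k, l) = (0, 1, 6, 7)) :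
    vec (ebar i) * (vec (ebar j) * (vec (ebar k) * (vec (ebar l) * spinorA))) = -spinorA := by
  have := congrArg (· * (1 + beta8)) (volume_mul_spinorA8 i j k l h)
  simpa only [mul_assoc, neg_mul, spinorA] using this

lemma vec_0246_mul_spinorA :
    vec (ebar 0) * (vec (ebar 2) * (vec (ebar 4) * (vec (ebar 6) * spinorA))) = spinorA := by
  have := beta8_mul_spinorA
  rwa [beta8, mul_assoc, mul_assoc, mul_assoc] at this

/-- Monomials that fix `spinorA` up to sign are closed under multiplication; inserting one relation
into another produces this one and the next four. -/
lemma vec_4567_mul_spinorA :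
    vec (ebar 4) * (vec (ebar 5) * (vec (ebar 6) * (vec (ebar 7) * spinorA))) = -spinorA := by
  have h := volume_mul_spinorA 0 1 4 5 (by decide)
  conv at h =>
    lhs
    rw [← neg_neg spinorA, ← volume_mul_spinorA 0 1 6 7 (by decide)]
  simpa (discharger := decide) only [vec_ebar_swap_assoc, vec_ebar_sq_assoc, mul_neg, neg_neg]
    using h

lemma vec_2345_mul_spinorA :
    vec (ebar 2) * (vec (ebar 3) * (vec (ebar 4) * (vec (ebar 5) * spinorA))) = -spinorA := by
  have h := volume_mul_spinorA 0 1 2 3 (by decide)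
  conv at h =>
    lhs
    rw [← neg_neg spinorA, ← volume_mul_spinorA 0 1 4 5 (by decide)]
  simpa (discharger := decide) only [vec_ebar_swap_assoc, vec_ebar_sq_assoc, mul_neg, neg_neg]
    using h

lemma vec_0257_mul_spinorA :
    vec (ebar 0) * (vec (ebar 2) * (vec (ebar 5) * (vec (ebar 7) * spinorA))) = -spinorA := by
  have h := vec_0246_mul_spinorA
  conv at h =>
    lhs
    rw [← neg_neg spinorA, ← vec_4567_mul_spinorA]
  simp (discharger := decide) only [vec_ebar_swap_assoc, vec_ebar_sq_assoc, mul_neg, neg_neg] at h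
  exact neg_eq_iff_eq_neg.1 h

lemma vec_0356_mul_spinorA :
    vec (ebar 0) * (vec (ebar 3) * (vec (ebar 5) * (vec (ebar 6) * spinorA))) = -spinorA := by
  have h := vec_0246_mul_spinorA
  conv at h =>
    lhs
    rw [← neg_neg spinorA, ← vec_2345_mul_spinorA]
  simp (discharger := decide) only [vec_ebar_swap_assoc, vec_ebar_sq_assoc, mul_neg, neg_neg] at h
  exact neg_eq_iff_eq_neg.1 h

lemma vec_0347_mul_spinorA :
    vec (ebar 0) * (vec (ebar 3) * (vec (ebar 4) * (vec (ebar 7) * spinorA))) = -spinorA := by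
  have h := vec_0356_mul_spinorA
  conv at h =>
    lhs
    rw [← neg_neg spinorA, ← vec_4567_mul_spinorA]
  simp (discharger := decide) only [vec_ebar_swap_assoc, vec_ebar_sq_assoc, mul_neg, neg_neg] at h
  exact h

/-- A stabilizing monomial `e₀ e_j e_k e_l` gives rewriting rules for products of pairs. -/
lemma pair_mul_of_stabilizing {j k l : Fin 8} (h0 : 0 < j) (hjk : j < k) (hkl : k < l) {s : ℝ}
    (h : vec (ebar 0) * (vec (ebar j) * (vec (ebar k) * (vec (ebar l) * spinorA))) = s • spinorA) :
    vec (ebar k) * (vec (ebar l) * spinorA) = -(s • (vec (ebar 0) * (vec (ebar j) * spinorA))) ∧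
    vec (ebar j) * (vec (ebar l) * spinorA) = s • (vec (ebar 0) * (vec (ebar k) * spinorA)) ∧
    vec (ebar j) * (vec (ebar k) * spinorA) = -(s • (vec (ebar 0) * (vec (ebar l) * spinorA))) := by
  have hk := h0.trans hjk
  have hl := hk.trans hkl
  refine ⟨?_, ?_, ?_⟩
  · have := congrArg (fun x => vec (ebar j) * (vec (ebar 0) * x)) h
    simp only [vec_ebar_sq_assoc, mul_neg, neg_neg, mul_smul_comm, vec_ebar_swap_assoc h0,
      smul_neg] at this
    exact this
  · have := congrArg (fun x => vec (ebar k) * (vec (ebar 0) * x)) h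
    simp only [vec_ebar_sq_assoc, mul_neg, neg_neg, mul_smul_comm,
      vec_ebar_swap_assoc hk, vec_ebar_swap_assoc hjk, smul_neg, neg_inj] at this
    exact this
  · have := congrArg (fun x => vec (ebar l) * (vec (ebar 0) * x)) h
    simp only [vec_ebar_sq_assoc, mul_neg, neg_neg, mul_smul_comm,
      vec_ebar_swap_assoc hl, vec_ebar_swap_assoc hkl, vec_ebar_swap_assoc (hjk.trans hkl),
      smul_neg] at this
    exact this

lemma inner_ebar_right (a : R8) (i : Fin 8) : ⟪a, ebar i⟫_ℝ = a i := by
  rw [real_inner_comm]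
  simp [ebar, EuclideanSpace.inner_single_left]

lemma vec_eq_sum (a : R8) : vec a = a 0 • vec (ebar 0) + a 1 • vec (ebar 1) + a 2 • vec (ebar 2) +
    a 3 • vec (ebar 3) + a 4 • vec (ebar 4) + a 5 • vec (ebar 5) + a 6 • vec (ebar 6) +
    a 7 • vec (ebar 7) := by
  conv_lhs => rw [← sum_inner_vec a]
  simp only [Fin.sum_univ_eight, inner_ebar_right]

/-- The triples `123, 145, 167, 246, 257, 347, 356` that complete `0` to a stabilizing monomial are
the lines of a Fano plane. Each pair of distinct nonzero indices lies on exactly one line, so the 21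
rules reduce every product to a combination of the `e_k A`, and the coefficients are those of
`crossFun`. -/
lemma vec_mul_vec_mul_spinorA (a v : R8) :
    vec a * (vec (ebar 0) * (vec v * spinorA)) = vec (cross a v) * spinorA := by
  have n (x : Cl8) : -x = (-1 : ℝ) • x := (neg_one_smul ℝ x).symm
  obtain ⟨r1, r2, r3⟩ := pair_mul_of_stabilizing (j := 1) (k := 2) (l := 3) (s := -1) (by decide)
    (by decide) (by decide) (by rw [← n]; exact volume_mul_spinorA _ _ _ _ (by decide))
  obtain ⟨r4, r5, r6⟩ := pair_mul_of_stabilizing (j := 1) (k := 4) (l := 5) (s := -1) (by decide)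
    (by decide) (by decide) (by rw [← n]; exact volume_mul_spinorA _ _ _ _ (by decide))
  obtain ⟨r7, r8, r9⟩ := pair_mul_of_stabilizing (j := 1) (k := 6) (l := 7) (s := -1) (by decide)
    (by decide) (by decide) (by rw [← n]; exact volume_mul_spinorA _ _ _ _ (by decide))
  obtain ⟨r10, r11, r12⟩ := pair_mul_of_stabilizing (j := 2) (k := 4) (l := 6) (s := 1) (by decide)
    (by decide) (by decide) (by rw [one_smul]; exact vec_0246_mul_spinorA)
  obtain ⟨r13, r14, r15⟩ := pair_mul_of_stabilizing (j := 2) (k := 5) (l := 7) (s := -1) (by decide)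
    (by decide) (by decide) (by rw [← n]; exact vec_0257_mul_spinorA)
  obtain ⟨r16, r17, r18⟩ := pair_mul_of_stabilizing (j := 3) (k := 4) (l := 7) (s := -1) (by decide)
    (by decide) (by decide) (by rw [← n]; exact vec_0347_mul_spinorA)
  obtain ⟨r19, r20, r21⟩ := pair_mul_of_stabilizing (j := 3) (k := 5) (l := 6) (s := -1) (by decide)
    (by decide) (by decide) (by rw [← n]; exact vec_0356_mul_spinorA)
  rw [vec_eq_sum a, vec_eq_sum v, vec_eq_sum (cross a v)]
  simp (discharger := decide) only [add_mul, mul_add, smul_mul_assoc, mul_smul_comm, mul_neg,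
    vec_ebar_swap_assoc, vec_ebar_sq_assoc, r1, r2, r3, r4, r5, r6, r7, r8, r9, r10, r11, r12,
    r13, r14, r15, r16, r17, r18, r19, r20, r21]
  simp only [cross_apply, crossFun, PiLp.toLp_apply, Matrix.cons_val]
  module

/-! ### The spinor `A` does not vanish -/

/-- The Clifford multiplication by vectors on the sum of the two half-spinor spaces. -/
def cliffordAction : R8 →ₗ[ℝ] Module.End ℝ (R8 × R8) :=
  LinearMap.mk₂ ℝ (fun a s => (cross a s.2 + (2 * ⟪a, ebar 0⟫_ℝ) • s.2, cross a s.1))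
    (fun a a' s => by
      ext1 <;> simp only [map_add, add_apply, inner_add_left, Prod.mk_add_mk]
      module)
    (fun c a s => by
      ext1 <;> simp only [map_smul, smul_apply, inner_smul_left, conj_trivial, Prod.smul_mk]
      module)
    (fun a s s' => by
      ext1 <;> simp only [map_add, Prod.fst_add, Prod.snd_add, Prod.mk_add_mk]
      module)
    (fun c a s => by
      ext1 <;> simp only [map_smul, Prod.smul_fst, Prod.smul_snd, Prod.smul_mk]
      module)

lemma cliffordAction_apply (a : R8) (s : R8 × R8) :
    cliffordAction a s = (cross a s.2 + (2 * ⟪a, ebar 0⟫_ℝ) • s.2, cross a s.1) := rfl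

lemma cliffordAction_sq (a : R8) :
    cliffordAction a * cliffordAction a = algebraMap ℝ _ (negSq a) := by
  have hq : negSq a = -⟪a, a⟫_ℝ := by
    simp only [negSq, neg_apply, LinearMap.BilinMap.toQuadraticMap_apply, innerₗ_apply_apply]
  refine LinearMap.ext fun s => ?_
  have h1 := spinPair_self a s.1
  have h2 := spinPair_self a s.2
  rw [spinPair_apply] at h1 h2
  rw [hq, Module.algebraMap_end_apply, Module.End.mul_apply, cliffordAction_apply,
    cliffordAction_apply]
  refine Prod.ext h1 ?_
  rw [map_add, map_smul]
  exact h2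

/-- The spin representation of the Clifford algebra. -/
def cliffordRep : Cl8 →ₐ[ℝ] Module.End ℝ (R8 × R8) :=
  CliffordAlgebra.lift negSq ⟨cliffordAction, cliffordAction_sq⟩

lemma cliffordRep_vec (a : R8) : cliffordRep (vec a) = cliffordAction a := by
  rw [cliffordRep, vec, CliffordAlgebra.lift_ι_apply]

lemma ebar_eq (i : Fin 8) : ebar i = WithLp.toLp 2 (Pi.single i 1) := by
  simp [ebar]

lemma cross_ebar_4_6 : cross (ebar 4) (ebar 6) = -ebar 2 := by
  ext i; fin_cases i <;> simp [cross_apply, crossFun, ebar]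

lemma cross_ebar_5_7 : cross (ebar 5) (ebar 7) = ebar 2 := by
  ext i; fin_cases i <;> simp [cross_apply, crossFun, ebar]

lemma cross_ebar_4_7 : cross (ebar 4) (ebar 7) = ebar 3 := by
  ext i; fin_cases i <;> simp [cross_apply, crossFun, ebar]

lemma cross_ebar_5_6 : cross (ebar 5) (ebar 6) = ebar 3 := by
  ext i; fin_cases i <;> simp [cross_apply, crossFun, ebar]

lemma cross_ebar_2_2 : cross (ebar 2) (ebar 2) = ebar 0 := by
  ext i; fin_cases i <;> simp [cross_apply, crossFun, ebar]

lemma cross_ebar_2_3 : cross (ebar 2) (ebar 3) = ebar 1 := by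
  ext i; fin_cases i <;> simp [cross_apply, crossFun, ebar]

lemma cross_ebar_3_2 : cross (ebar 3) (ebar 2) = -ebar 1 := by
  ext i; fin_cases i <;> simp [cross_apply, crossFun, ebar]

lemma cross_ebar_3_3 : cross (ebar 3) (ebar 3) = ebar 0 := by
  ext i; fin_cases i <;> simp [cross_apply, crossFun, ebar]

lemma cross_ebar_1_1 : cross (ebar 1) (ebar 1) = ebar 0 := by
  ext i; fin_cases i <;> simp [cross_apply, crossFun, ebar]

lemma cliffordAction_fst {i : Fin 8} (h : i ≠ 0) (s : R8 × R8) :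
    (cliffordAction (ebar i) s).1 = cross (ebar i) s.2 := by
  rw [cliffordAction_apply, inner_ebar_ebar, if_neg h, mul_zero, zero_smul, add_zero]

lemma cliffordAction_zero_fst (s : R8 × R8) : (cliffordAction (ebar 0) s).1 = s.2 := by
  rw [cliffordAction_apply, inner_ebar_ebar, if_pos rfl, cross_ebar_zero_left]
  module

lemma cliffordAction_snd (a : R8) (s : R8 × R8) : (cliffordAction a s).2 = cross a s.1 := rfl

/-- The test vector `(ebar 0, 0)` of the spin representation is fixed by `beta8`, so the factor `1 +
beta8` only doubles it. Each of the eight signed monomials of `spinorA8` then contributes `+1` to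
the component along `ebar 0`, and the total `8` is not zero. -/
lemma spinorA_ne_zero : spinorA ≠ 0 := by
  intro h
  have hβ : cliffordRep beta8 (ebar 0, 0) = (ebar 0, 0) := by
    simp only [beta8, map_mul, cliffordRep_vec, Module.End.mul_apply]
    refine Prod.ext ?_ ?_
    · simp (discharger := decide) only [cliffordAction_fst, cliffordAction_zero_fst,
        cliffordAction_snd, cross_ebar_zero_right, map_neg, cross_ebar_4_6, neg_neg, cross_ebar_2_2]
    · simp [cliffordAction_apply]
  have h1 : cliffordRep spinorA (ebar 0, 0) = 0 := by simp [h]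
  rw [spinorA, map_mul, map_add, map_one, Module.End.mul_apply, LinearMap.add_apply,
    Module.End.one_apply, hβ, ← two_smul ℝ, map_smul, smul_eq_zero_iff_right two_ne_zero] at h1
  have h2 := congrArg (fun s : R8 × R8 => ⟪s.1, ebar 0⟫_ℝ) h1
  simp (discharger := decide) only [spinorA8_eq, map_mul, map_add, map_sub, cliffordRep_vec,
    Module.End.mul_apply, LinearMap.add_apply, LinearMap.sub_apply, Prod.fst_add, Prod.fst_sub,
    cliffordAction_fst, cliffordAction_zero_fst, cliffordAction_snd, cross_ebar_zero_right, map_neg,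
    cross_ebar_4_6, cross_ebar_5_7, cross_ebar_4_7, cross_ebar_5_6, cross_ebar_2_2, cross_ebar_2_3,
    cross_ebar_3_2, cross_ebar_3_3, cross_ebar_1_1, neg_neg, inner_add_left, inner_sub_left,
    inner_neg_left, ebar_zero_inner_self, Prod.fst_zero, inner_zero_left] at h2
  norm_num at h2

/-- A second multiplication by `v - w` gives the scalar `-|v - w|²` times the nonzero element
`spinorA`. -/
lemma vec_mul_spinorA_injective {v w : R8} (h : vec v * spinorA = vec w * spinorA) : v = w := by
  have h1 : vec (v - w) * spinorA = 0 := by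
    rw [vec, map_sub, sub_mul]
    exact sub_eq_zero.2 h
  have h2 := congrArg (vec (v - w) * ·) h1
  simp only [← mul_assoc, vec_mul_self, mul_zero] at h2
  rw [← Algebra.smul_def, smul_eq_zero, or_iff_left spinorA_ne_zero, neg_eq_zero,
    inner_self_eq_zero] at h2
  exact sub_eq_zero.1 h2

/-! ### The defining equations of the spin representation and of `τ` -/

lemma vec_zero_mul_injective {x y : Cl8} (h : vec (ebar 0) * x = vec (ebar 0) * y) : x = y := by
  have := congrArg (vec (ebar 0) * ·) h
  simpa only [vec_ebar_sq_assoc, neg_inj] using this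

lemma vec_mul_vec_mul_posSpinor (a b w : R8) :
    vec a * vec b * (vec (ebar 0) * vec w * spinorA) =
      vec (ebar 0) * vec (spinPair a b w) * spinorA := by
  -- The action on negative spinors: moving `ebar 0` past `a` costs the scalar `2 ⟪a, ebar 0⟫`,
  -- which explains the extra term in `spinPair`.
  have h : ∀ u, vec a * (vec u * spinorA) =
      vec (ebar 0) * (vec (cross a u + (2 * ⟪a, ebar 0⟫_ℝ) • u) * spinorA) := by
    intro u
    have h1 := congrArg (· * (vec (ebar 0) * (vec u * spinorA))) (vec_mul_add (ebar 0) a)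
    simp only [add_mul, mul_assoc, vec_mul_vec_mul_spinorA, ← Algebra.smul_def,
      cross_ebar_zero_left] at h1
    rw [real_inner_comm] at h1
    have h2 : ∀ y z : R8, ∀ c : ℝ, vec (y + c • z) = vec y + c • vec z := fun y z c => by
      simp only [vec, map_add, map_smul]
    have h3 : vec (-u) = -vec u := by simp only [vec, map_neg]
    rw [h3, neg_mul, mul_neg, ← sub_eq_add_neg, sub_eq_iff_eq_add] at h1
    rw [h2, add_mul, mul_add, smul_mul_assoc, mul_smul_comm, h1]
    module
  simp only [mul_assoc]
  rw [vec_mul_vec_mul_spinorA, h, ← spinPair_apply]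

lemma toCl_mul_posSpinor (x : R8 →L[ℝ] R8) (w : R8) :
    toCl x * (vec (ebar 0) * vec w * spinorA) =
      vec (ebar 0) * vec (spinLin x w) * spinorA := by
  simp only [toCl, smul_mul_assoc, Finset.sum_mul, vec_mul_vec_mul_posSpinor]
  rw [spinLin_apply]
  simp only [vec, map_smul, map_sum, mul_smul_comm, smul_mul_assoc, Finset.mul_sum, Finset.sum_mul]

lemma sum_smul_posSpinor (c : Fin 8 → ℝ) :
    ∑ i, c i • posSpinor i = vec (ebar 0) * vec (WithLp.toLp 2 c) * spinorA := by
  rw [← sum_inner_vec (WithLp.toLp 2 c), Finset.mul_sum, Finset.sum_mul]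
  refine Finset.sum_congr rfl fun i _ => ?_
  rw [inner_ebar_right, mul_smul_comm, smul_mul_assoc, posSpinor]

lemma clm_ext_ebar {T T' : R8 →L[ℝ] R8} (h : ∀ j, T (ebar j) = T' (ebar j)) : T = T' := by
  refine ContinuousLinearMap.ext fun w => ?_
  rw [← sum_inner_ebar_smul w, map_sum, map_sum]
  simp only [map_smul, h]

lemma isSpinMatrix_iff (x : R8 →L[ℝ] R8) (B : Matrix (Fin 8) (Fin 8) ℝ) :
    IsSpinMatrix x B ↔ Matrix.toEuclideanCLM (𝕜 := ℝ) B = spinLin x := by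
  have key : ∀ j, (toCl x * posSpinor j = ∑ i, B i j • posSpinor i) ↔
      Matrix.toEuclideanCLM (𝕜 := ℝ) B (ebar j) = spinLin x (ebar j) := by
    intro j
    have h1 : Matrix.toEuclideanCLM (𝕜 := ℝ) B (ebar j) = WithLp.toLp 2 fun i => B i j := by
      rw [ebar_eq, Matrix.toEuclideanCLM_toLp, Matrix.mulVec_single_one]
      rfl
    rw [sum_smul_posSpinor, posSpinor, toCl_mul_posSpinor, h1]
    constructor
    · intro h
      simp only [mul_assoc] at h
      exact (vec_mul_spinorA_injective (vec_zero_mul_injective h)).symm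
    · intro h
      rw [h]
  constructor
  · intro h
    exact clm_ext_ebar fun j => (key j).1 (h j)
  · intro h j
    exact (key j).2 (by rw [h])

lemma existsUnique_isSpinMatrix (x : R8 →L[ℝ] R8) :
    ∃! B : Matrix (Fin 8) (Fin 8) ℝ, IsSpinMatrix x B := by
  simp only [isSpinMatrix_iff]
  exact (Matrix.toEuclideanCLM (𝕜 := ℝ) (n := Fin 8)).bijective.existsUnique (spinLin x)

lemma spinOp_eq (x : R8 →L[ℝ] R8) : spinOp x = spinLin x :=
  (isSpinMatrix_iff x _).1 (Classical.epsilon_spec (existsUnique_isSpinMatrix x).exists)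

lemma toCl_mul_spinorA_iff (x : R8 →L[ℝ] R8) (v : R8) :
    toCl x * spinorA = vec (ebar 0) * vec v * spinorA ↔ v = -spinLin x (ebar 0) := by
  -- Up to sign `spinorA` is the first positive spinor, so `τ x` is minus the first column of
  -- `Φ^*(x)`.
  have h1 : spinorA = -(vec (ebar 0) * vec (ebar 0) * spinorA) := by
    rw [mul_assoc, vec_ebar_sq_assoc, neg_neg]
  have h2 : toCl x * spinorA = vec (ebar 0) * vec (-spinLin x (ebar 0)) * spinorA := by
    conv_lhs => rw [h1]
    rw [mul_neg, toCl_mul_posSpinor]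
    simp only [vec, map_neg, mul_neg, neg_mul]
  rw [h2]
  constructor
  · intro h
    simp only [mul_assoc] at h
    exact (vec_mul_spinorA_injective (vec_zero_mul_injective h)).symm
  · rintro rfl
    rfl

lemma existsUnique_tau {x : R8 →L[ℝ] R8} (hx : -spinLin x (ebar 0) ∈ S6) :
    ∃! v : R8, v ∈ S6 ∧ toCl x * spinorA = vec (ebar 0) * vec v * spinorA := by
  simp only [toCl_mul_spinorA_iff]
  exact ⟨_, ⟨hx, rfl⟩, fun _ h => h.2⟩

lemma tau_eq_of_mem {x : R8 →L[ℝ] R8} (hx : -spinLin x (ebar 0) ∈ S6) :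
    tau x = -spinLin x (ebar 0) :=
  (toCl_mul_spinorA_iff x _).1 (Classical.epsilon_spec (existsUnique_tau hx).exists).2

/-! ### The inverse of the spin representation -/

/-- `crossAdj a` is the adjoint of `cross a`. -/
def crossAdj : R8 →L[ℝ] R8 →L[ℝ] R8 :=
  -(cross + (2 • innerSL ℝ (ebar 0)).smulRight (ContinuousLinearMap.id ℝ R8))

lemma crossAdj_apply (a w : R8) : crossAdj a w = -(cross a w + (2 * ⟪a, ebar 0⟫_ℝ) • w) := by
  simp [crossAdj, real_inner_comm a]

lemma spinPair_eq (a b w : R8) : spinPair a b w = -crossAdj a (cross b w) := by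
  rw [crossAdj_apply, neg_neg, spinPair_apply]

lemma crossAdj_cross_add (a b w : R8) :
    crossAdj a (cross b w) + crossAdj b (cross a w) = (2 * ⟪a, b⟫_ℝ) • w := by
  have := spinPair_add_swap a b w
  rw [spinPair_eq, spinPair_eq, ← neg_add, neg_eq_iff_eq_neg] at this
  rw [this]
  module

lemma cross_crossAdj_add (a b w : R8) :
    cross a (crossAdj b w) + cross b (crossAdj a w) = (2 * ⟪a, b⟫_ℝ) • w := by
  rw [← crossAdj_cross_add]
  simp only [crossAdj_apply, map_neg, map_add, map_smul]
  abel

/-- Contraction over a basis turns the action of `a b` on one half-spinor space into the action on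
the other. The factor is `8 - 2 - 2`: eight undisturbed terms, and a correction of `2` from moving
`e_i` past each of `a` and `b`. -/
lemma sum_cross_crossAdj (a b w : R8) (hab : ⟪a, b⟫_ℝ = 0) :
    ∑ i, cross (ebar i) (crossAdj a (cross b (crossAdj (ebar i) w))) =
      (4 : ℝ) • cross a (crossAdj b w) := by
  have h1 : ∀ i, cross (ebar i) (crossAdj a (cross b (crossAdj (ebar i) w))) =
      (2 : ℝ) • cross b (crossAdj (⟪a, ebar i⟫_ℝ • ebar i) w) -
        (2 : ℝ) • cross a (crossAdj (⟪b, ebar i⟫_ℝ • ebar i) w) + cross a (crossAdj b w) := by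
    intro i
    have e1 := cross_crossAdj_add (ebar i) a (cross b (crossAdj (ebar i) w))
    have e2 := crossAdj_cross_add (ebar i) b (crossAdj (ebar i) w)
    have e3 := cross_crossAdj_add (ebar i) (ebar i) w
    rw [inner_ebar_ebar, if_pos rfl, ← two_smul ℝ, mul_one,
      smul_right_inj two_ne_zero] at e3
    rw [e3, ← eq_sub_iff_add_eq] at e2
    rw [e2, ← eq_sub_iff_add_eq] at e1
    rw [e1, real_inner_comm a, real_inner_comm b]
    simp only [map_sub, map_smul, smul_apply]
    module
  have h2 : ∀ a : R8, ∑ i, crossAdj (⟪a, ebar i⟫_ℝ • ebar i) w = crossAdj a w := fun a => by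
    conv_rhs => rw [← sum_inner_ebar_smul a]
    rw [map_sum, sum_apply]
  rw [Finset.sum_congr rfl fun i _ => h1 i, Finset.sum_add_distrib, Finset.sum_sub_distrib,
    ← Finset.smul_sum, ← Finset.smul_sum, ← map_sum, ← map_sum, h2, h2]
  have h3 := cross_crossAdj_add a b w
  rw [hab, mul_zero, zero_smul] at h3
  rw [eq_neg_of_add_eq_zero_right h3]
  simp only [Finset.sum_const, Finset.card_univ, Fintype.card_fin]
  module

/-- The inverse of `spinLin` on the bivectors. -/
def spinInv : (R8 →L[ℝ] R8) →ₗ[ℝ] (R8 →L[ℝ] R8) where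
  toFun T := (1 / 2 : ℝ) • ((1 / 4 : ℝ) • ∑ i, cross (ebar i) ∘L T ∘L crossAdj (ebar i) +
    cross.flip (T (ebar 0)))
  map_add' T T' := by
    simp only [ContinuousLinearMap.add_comp, ContinuousLinearMap.comp_add, add_apply, map_add,
      smul_add, Finset.sum_add_distrib]
    abel
  map_smul' c T := by
    simp only [ContinuousLinearMap.smul_comp, ContinuousLinearMap.comp_smul, smul_apply, map_smul,
      RingHom.id_apply, ← Finset.smul_sum]
    module

/-- Triality. Clifford multiplication `cross` is equivariant: if `T₊`, `T₋` are the actions of `a b`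
on the half-spinors and `X` its commutator action on vectors, then `T₋ (cross c s) = cross (X c) s +
cross c (T₊ s)`. At `s = ebar 0` this reads `X c = T₋ c + cross c (T₊ (ebar 0))`, where `T₋` is the
contracted sum. The outer factor `1 / 2` is there because `X = 2 (a ∧ b)`. -/
lemma spinInv_spinLin_wedge (a b : R8) (hab : ⟪a, b⟫_ℝ = 0) :
    spinInv (spinLin (wedge a b)) = wedge a b := by
  refine ContinuousLinearMap.ext fun c => ?_
  have h1 := sum_cross_crossAdj a b c hab
  have h2 := cross_crossAdj_add c a b
  have h3 := congrArg (cross a) (crossAdj_cross_add b c (ebar 0))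
  simp only [cross_ebar_zero_right, map_neg, map_add, map_smul] at h3
  simp only [spinInv, LinearMap.coe_mk, AddHom.coe_mk, smul_apply, add_apply, sum_apply,
    ContinuousLinearMap.comp_apply, spinLin_wedge _ _ _ hab, spinPair_eq, map_neg,
    Finset.sum_neg_distrib, ContinuousLinearMap.flip_apply, neg_apply, cross_ebar_zero_right]
  rw [h1, eq_sub_of_add_eq h2]
  have h4 : cross a (crossAdj b c) = (2 * ⟪b, c⟫_ℝ) • a - cross a (crossAdj c b) := by
    rw [smul_neg] at h3
    rw [← neg_neg ((2 * ⟪b, c⟫_ℝ) • a), ← h3]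
    abel
  simp only [wedge, sub_apply, ContinuousLinearMap.smulRight_apply, innerSL_apply_apply]
  rw [h4, real_inner_comm a c]
  module

/-! ### The complex structures on `ℝ⁸` defined by planes -/

lemma orthonormal_pair_iff {a b : R8} :
    Orthonormal ℝ ![a, b] ↔ ⟪a, a⟫_ℝ = 1 ∧ ⟪b, b⟫_ℝ = 1 ∧ ⟪a, b⟫_ℝ = 0 := by
  rw [orthonormal_iff_ite]
  simp only [Fin.forall_fin_two, Matrix.cons_val_zero, Matrix.cons_val_one, if_true,
    Fin.zero_eq_one_iff, Fin.one_eq_zero_iff, OfNat.ofNat_ne_one, if_false]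
  constructor
  · rintro ⟨⟨h1, h2⟩, -, h3⟩
    exact ⟨h1, h3, h2⟩
  · rintro ⟨h1, h3, h2⟩
    exact ⟨⟨h1, h2⟩, by rw [real_inner_comm]; exact h2, h3⟩

lemma spinInv_spinLin {x : R8 →L[ℝ] R8} (hx : x ∈ G28) : spinInv (spinLin x) = x := by
  obtain ⟨a, b, h, rfl⟩ := hx
  exact spinInv_spinLin_wedge a b (orthonormal_pair_iff.1 h).2.2

lemma spinLin_spinLin {x : R8 →L[ℝ] R8} (hx : x ∈ G28) (w : R8) :
    spinLin x (spinLin x w) = -w := by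
  obtain ⟨a, b, h, rfl⟩ := hx
  obtain ⟨ha, hb, hab⟩ := orthonormal_pair_iff.1 h
  rw [spinLin_wedge _ _ _ hab, spinLin_wedge _ _ _ hab]
  have h1 := spinPair_add_swap a b (spinPair a b w)
  rw [hab, mul_zero, zero_smul, spinPair_comp, spinPair_self, ha, hb] at h1
  rw [eq_neg_of_add_eq_zero_left h1]
  simp

lemma inner_spinLin {x : R8 →L[ℝ] R8} (hx : x ∈ G28) (w u : R8) :
    ⟪spinLin x w, spinLin x u⟫_ℝ = ⟪w, u⟫_ℝ := by
  obtain ⟨a, b, h, rfl⟩ := hx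
  obtain ⟨ha, hb, hab⟩ := orthonormal_pair_iff.1 h
  rw [spinLin_wedge _ _ _ hab, spinLin_wedge _ _ _ hab, inner_spinPair,
    cross_adjoint_cross _ _ _ ha, inner_neg_right, inner_cross_left, hb, one_mul, neg_neg]

lemma inner_spinLin_swap {x : R8 →L[ℝ] R8} (hx : x ∈ G28) (w u : R8) :
    ⟪spinLin x w, u⟫_ℝ = -⟪w, spinLin x u⟫_ℝ := by
  rw [← inner_spinLin hx w, spinLin_spinLin hx, inner_neg_right, neg_neg]

lemma neg_spinLin_mem_S6 {x : R8 →L[ℝ] R8} (hx : x ∈ G28) : -spinLin x (ebar 0) ∈ S6 := by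
  constructor
  · rw [norm_neg, ← sq_eq_sq₀ (norm_nonneg _) zero_le_one, ← real_inner_self_eq_norm_sq,
      inner_spinLin hx, ebar_zero_inner_self, one_pow]
  · have := inner_spinLin_swap hx (ebar 0) (ebar 0)
    rw [real_inner_comm] at this
    rw [inner_neg_right]
    linarith

lemma tau_eq {x : R8 →L[ℝ] R8} (hx : x ∈ G28) : tau x = -spinLin x (ebar 0) :=
  tau_eq_of_mem (neg_spinLin_mem_S6 hx)

lemma tau_mem_S6 {x : R8 →L[ℝ] R8} (hx : x ∈ G28) : tau x ∈ S6 := by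
  rw [tau_eq hx]
  exact neg_spinLin_mem_S6 hx

lemma spinLin_ebar_zero {x : R8 →L[ℝ] R8} (hx : x ∈ G28) : spinLin x (ebar 0) = -tau x := by
  rw [tau_eq hx, neg_neg]

lemma spinLin_tau {x : R8 →L[ℝ] R8} (hx : x ∈ G28) : spinLin x (tau x) = ebar 0 := by
  rw [tau_eq hx, map_neg, spinLin_spinLin hx, neg_neg]

lemma S6_inner_self {v : R8} (hv : v ∈ S6) : ⟪v, v⟫_ℝ = 1 := by
  rw [real_inner_self_eq_norm_sq, hv.1, one_pow]

/-! ### The complex structure on `ℝ⁸` defined by a point of `S⁶` -/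

/-- The fibre of `τ` over `v` consists of the complex lines of the complex structure `cplx v`. -/
def cplx : R8 →L[ℝ] R8 →L[ℝ] R8 := -cross.flip

lemma cplx_apply (v a : R8) : cplx v a = -cross a v := rfl

lemma inner_cplx_swap {v : R8} (hv : ⟪ebar 0, v⟫_ℝ = 0) (a b : R8) :
    ⟪cplx v a, b⟫_ℝ = -⟪a, cplx v b⟫_ℝ := by
  rw [cplx_apply, cplx_apply, inner_neg_left, inner_cross_swap', hv, inner_neg_right]
  ring

lemma inner_cplx (v a b : R8) : ⟪cplx v a, cplx v b⟫_ℝ = ⟪v, v⟫_ℝ * ⟪a, b⟫_ℝ := by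
  rw [cplx_apply, cplx_apply, inner_neg_neg, mul_comm, ← inner_cross_right]

/-- The Clifford relations of `ℝ⁷ = (ebar 0)ᗮ` acting on `ℝ⁸`. They produce both the intertwiner
`transport` and the involutions of `exists_plane_of_pairs`. -/
lemma cplx_add_swap {v w : R8} (hv : ⟪ebar 0, v⟫_ℝ = 0) (hw : ⟪ebar 0, w⟫_ℝ = 0) (a : R8) :
    cplx v (cplx w a) + cplx w (cplx v a) = (-2 * ⟪v, w⟫_ℝ) • a := by
  refine ext_inner_right ℝ fun u => ?_
  have h1 := inner_cplx_swap hv (cplx w a) u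
  have h2 := inner_cplx_swap hw (cplx v a) u
  have h3 := inner_cross_add' a u v w
  simp only [cplx_apply v u, cplx_apply w u, cplx_apply w a, cplx_apply v a, inner_neg_neg]
    at h1 h2 ⊢
  rw [inner_add_left, inner_smul_left, h1, h2, conj_trivial]
  linarith

lemma cplx_cplx {v : R8} (hv : ⟪ebar 0, v⟫_ℝ = 0) (a : R8) :
    cplx v (cplx v a) = -⟪v, v⟫_ℝ • a := by
  have := cplx_add_swap hv hv a
  rw [← two_smul ℝ, neg_mul, ← mul_neg, mul_smul] at this
  exact smul_right_injective _ two_ne_zero this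

lemma orthonormal_cplx {v a : R8} (hv : v ∈ S6) (ha : ⟪a, a⟫_ℝ = 1) :
    Orthonormal ℝ ![a, cplx v a] := by
  refine orthonormal_pair_iff.2 ⟨ha, ?_, ?_⟩
  · rw [inner_cplx, S6_inner_self hv, ha, one_mul]
  · have := inner_cplx_swap hv.2 a a
    rw [real_inner_comm] at this
    linarith

/-- For an orthonormal pair, `τ (a ∧ b)` is the solution `v` of `cross a v = -b`, which says `b =
cplx v a`. -/
lemma mem_fibre_iff {v : R8} (hv : v ∈ S6) (x : R8 →L[ℝ] R8) :
    x ∈ G28 ∧ tau x = v ↔ ∃ a : R8, ⟪a, a⟫_ℝ = 1 ∧ x = wedge a (cplx v a) := by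
  constructor
  · rintro ⟨hx, rfl⟩
    obtain ⟨a, b, h, rfl⟩ := id hx
    obtain ⟨ha, hb, hab⟩ := orthonormal_pair_iff.1 h
    refine ⟨a, ha, ?_⟩
    congr 1
    rw [cplx_apply, tau_eq hx, spinLin_wedge _ _ _ hab, map_neg, cross_adjoint_cross _ _ _ ha,
      cross_ebar_zero_right]
    simp
  · rintro ⟨a, ha, rfl⟩
    have h := orthonormal_cplx hv ha
    have hx : wedge a (cplx v a) ∈ G28 := ⟨_, _, h, rfl⟩
    refine ⟨hx, ?_⟩
    rw [tau_eq hx, spinLin_wedge _ _ _ (orthonormal_pair_iff.1 h).2.2, spinPair_eq,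
      cross_ebar_zero_right, cplx_apply, neg_neg, neg_neg]
    have := spinPair_self a v
    rwa [spinPair_eq, ha, neg_one_smul, neg_inj] at this

/-! ### The tangent spaces of `S⁶` -/

lemma mem_tangent {v w : R8} : w ∈ tangent v ↔ ⟪ebar 0, w⟫_ℝ = 0 ∧ ⟪v, w⟫_ℝ = 0 := by
  rw [Submodule.mem_orthogonal]
  constructor
  · intro h
    exact ⟨h _ (Submodule.subset_span (by simp)), h _ (Submodule.subset_span (by simp))⟩
  · rintro ⟨h1, h2⟩ u hu
    obtain ⟨c, d, rfl⟩ := Submodule.mem_span_pair.1 hu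
    simp [inner_add_left, inner_smul_left, h1, h2]

lemma spinLin_mem_tangent {x : R8 →L[ℝ] R8} (hx : x ∈ G28) {w : R8} (hw : w ∈ tangent (tau x)) :
    spinLin x w ∈ tangent (tau x) := by
  rw [mem_tangent] at hw ⊢
  constructor
  · rw [← neg_eq_zero, ← inner_spinLin_swap hx, spinLin_ebar_zero hx, inner_neg_left, hw.2,
      neg_zero]
  · rw [← neg_eq_zero, ← inner_spinLin_swap hx, spinLin_tau hx, hw.1]

lemma coe_onTangent {v : R8} {J : R8 →L[ℝ] R8} (w : tangent v) (hJ : J w ∈ tangent v) :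
    (onTangent v J w : R8) = J w :=
  congrArg Subtype.val ((tangent v).orthogonalProjectionOnto_mem_subspace_eq_self ⟨J w, hJ⟩)

lemma coe_onTangent_spinLin {x : R8 →L[ℝ] R8} (hx : x ∈ G28) (w : tangent (tau x)) :
    (onTangent (tau x) (spinLin x) w : R8) = spinLin x w :=
  coe_onTangent w (spinLin_mem_tangent hx w.2)

lemma coe_projection_tangent {v : R8} (hv : v ∈ S6) (w : R8) :
    ((tangent v).orthogonalProjectionOnto w : R8) = w - ⟪ebar 0, w⟫_ℝ • ebar 0 - ⟪v, w⟫_ℝ • v := by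
  have hv1 := S6_inner_self hv
  have hv0 : ⟪v, ebar 0⟫_ℝ = 0 := by rw [real_inner_comm]; exact hv.2
  have h0 := ebar_zero_inner_self
  refine Submodule.eq_starProjection_of_mem_of_inner_eq_zero ?_ ?_
  · rw [mem_tangent]
    simp only [inner_sub_right, inner_smul_right, h0, hv.2, hv0, hv1]
    constructor <;> ring
  · intro u hu
    rw [mem_tangent] at hu
    rw [show w - (w - ⟪ebar 0, w⟫_ℝ • ebar 0 - ⟪v, w⟫_ℝ • v) =
      ⟪ebar 0, w⟫_ℝ • ebar 0 + ⟪v, w⟫_ℝ • v by abel]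
    simp [inner_add_left, inner_smul_left, hu.1, hu.2]

lemma extend_apply {v : R8} (j : tangent v →L[ℝ] tangent v) (w : R8) :
    extend j w = j ((tangent v).orthogonalProjectionOnto w) := rfl

lemma extend_coe {v : R8} (j : tangent v →L[ℝ] tangent v) (w : tangent v) :
    extend j w = j w := by
  rw [extend_apply, Submodule.orthogonalProjectionOnto_mem_subspace_eq_self]

lemma extend_injective {v : R8} : Function.Injective (extend (v := v)) := by
  intro j j' h
  refine ContinuousLinearMap.ext fun w => Subtype.ext ?_
  rw [← extend_coe, ← extend_coe, h]

/-- On the plane of `ebar 0` and `τ x` the operator is the rotation `ebar 0 ↦ -τ x`, `τ x ↦ ebar 0`,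
which is the subtracted bivector. This explicit difference makes passing to the restriction and back
smooth. -/
lemma extend_onTangent {x : R8 →L[ℝ] R8} (hx : x ∈ G28) :
    extend (onTangent (tau x) (spinLin x)) = spinLin x - wedge (tau x) (ebar 0) := by
  refine ContinuousLinearMap.ext fun w => ?_
  rw [extend_apply, coe_onTangent_spinLin hx,
    coe_projection_tangent (tau_mem_S6 hx), map_sub, map_sub, map_smul, map_smul,
    spinLin_ebar_zero hx, spinLin_tau hx]
  simp only [wedge, sub_apply, ContinuousLinearMap.smulRight_apply, innerSL_apply_apply]
  module

/-- A plane is determined by `τ` and the complex structure on the tangent space. -/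
lemma eq_spinInv {x : R8 →L[ℝ] R8} (hx : x ∈ G28) :
    x = spinInv (extend (onTangent (tau x) (spinLin x)) + wedge (tau x) (ebar 0)) := by
  rw [extend_onTangent hx, sub_add_cancel, spinInv_spinLin hx]

lemma isOrthogonalComplexStructure_onTangent {x : R8 →L[ℝ] R8} (hx : x ∈ G28) :
    IsOrthogonalComplexStructure (onTangent (tau x) (spinLin x)) := by
  have h := coe_onTangent_spinLin hx
  refine ⟨fun w => Subtype.ext ?_, fun w w' => ?_⟩
  · rw [h, h, spinLin_spinLin hx, Submodule.coe_neg]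
  · change ⟪(onTangent (tau x) (spinLin x) w : R8), onTangent (tau x) (spinLin x) w'⟫_ℝ =
      ⟪(w : R8), w'⟫_ℝ
    rw [h, h, inner_spinLin hx]

/-! ### Orientations -/

/-- An operator that commutes with a complex structure is orientation preserving or singular. -/
lemma det_nonneg_of_commute {V : Type*} [AddCommGroup V] [Module ℝ V] [Module.Finite ℝ V]
    {J M : V →ₗ[ℝ] V} (hJ : J * J = -1) (h : M * J = J * M) : 0 ≤ LinearMap.det M := by
  let f : ℂ →ₐ[ℝ] Module.End ℝ V := Complex.lift ⟨J, hJ⟩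
  let _ : Module ℂ V := Module.compHom V f.toRingHom
  have hsmul (z : ℂ) (w : V) : z • w = z.re • w + z.im • J w := by
    change f z w = _
    simp [f, Complex.lift_apply, Complex.liftAux_apply, Module.algebraMap_end_apply]
  have : IsScalarTower ℝ ℂ V := ⟨fun c z w => by simp [hsmul, smul_add, smul_smul]⟩
  have hc (w : V) : M (J w) = J (M w) := LinearMap.congr_fun h w
  let M' : V →ₗ[ℂ] V :=
    { toFun := M
      map_add' := map_add M
      map_smul' := fun z w => by simp [hsmul, hc] }
  have : Module.Finite ℂ V := Module.Finite.of_restrictScalars_finite ℝ ℂ V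
  have h1 : M'.restrictScalars ℝ = M := rfl
  rw [← h1, LinearMap.det_restrictScalars, Algebra.norm_complex_apply]
  exact Complex.normSq_nonneg _

lemma det_ne_zero_of_injective {M : R8 →ₗ[ℝ] R8} (h : ∀ w, M w = 0 → w = 0) :
    LinearMap.det M ≠ 0 := by
  have := (LinearMap.isUnit_iff_ker_eq_bot M).2 (LinearMap.ker_eq_bot'.2 h)
  exact ((LinearMap.isUnit_iff_isUnit_det M).1 this).ne_zero

lemma cross_cross_self {u : R8} (h0 : ⟪u, ebar 0⟫_ℝ = 0) (w : R8) :
    cross u (cross u w) = -⟪u, u⟫_ℝ • w := by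
  have := spinPair_self u w
  rwa [spinPair_apply, h0, mul_zero, zero_smul, add_zero] at this

/-- Writing `c = s e₁ + t u` with a unit vector `u ⊥ e₁`, the operator `cross c` commutes with the
complex structure `cross u` and is injective. -/
lemma det_cross_pos {c : R8} (hc : c ≠ 0) : 0 < LinearMap.det (cross c : R8 →ₗ[ℝ] R8) := by
  have hu : ∃ (u : R8) (s t : ℝ), ⟪u, ebar 0⟫_ℝ = 0 ∧ ⟪u, u⟫_ℝ = 1 ∧ c = s • ebar 0 + t • u := by
    by_cases h : c - ⟪c, ebar 0⟫_ℝ • ebar 0 = 0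
    · refine ⟨ebar 1, ⟪c, ebar 0⟫_ℝ, 0, by simp [inner_ebar_ebar],
        by rw [inner_ebar_ebar, if_pos rfl], ?_⟩
      rw [zero_smul, add_zero]
      exact sub_eq_zero.1 h
    · set d := c - ⟪c, ebar 0⟫_ℝ • ebar 0
      have hd : ‖d‖ ≠ 0 := norm_ne_zero_iff.2 h
      refine ⟨‖d‖⁻¹ • d, ⟪c, ebar 0⟫_ℝ, ‖d‖, ?_, ?_, ?_⟩
      · rw [inner_smul_left, inner_sub_left, inner_smul_left, ebar_zero_inner_self]
        simp
      · rw [inner_smul_left, inner_smul_right, real_inner_self_eq_norm_sq]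
        simp only [conj_trivial]
        field_simp
      · rw [smul_inv_smul₀ hd]
        simp [d]
  obtain ⟨u, s, t, h0, h1, rfl⟩ := hu
  refine lt_of_le_of_ne' ?_ ?_
  · refine det_nonneg_of_commute (J := (cross u : R8 →ₗ[ℝ] R8)) ?_ ?_
    · refine LinearMap.ext fun w => ?_
      have := cross_cross_self h0 w
      rw [h1, neg_one_smul] at this
      exact this
    · refine LinearMap.ext fun w => ?_
      change cross (s • ebar 0 + t • u) (cross u w) = cross u (cross (s • ebar 0 + t • u) w)
      simp only [map_add, map_smul, add_apply, smul_apply, cross_ebar_zero_left, map_neg]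
  · refine det_ne_zero_of_injective fun w hw => ?_
    have := norm_cross (s • ebar 0 + t • u) w
    change cross (s • ebar 0 + t • u) w = 0 at hw
    rw [hw, norm_zero, eq_comm, mul_eq_zero, norm_eq_zero, norm_eq_zero] at this
    exact this.resolve_left hc

lemma crossAdj_cross (a w : R8) : crossAdj a (cross a w) = ⟪a, a⟫_ℝ • w := by
  have := spinPair_self a w
  rwa [spinPair_eq, neg_smul, neg_inj] at this

lemma det_crossAdj_pos {a : R8} (ha : ⟪a, a⟫_ℝ = 1) :
    0 < LinearMap.det (crossAdj a : R8 →ₗ[ℝ] R8) := by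
  have h1 : (crossAdj a : R8 →ₗ[ℝ] R8) * (cross a : R8 →ₗ[ℝ] R8) = 1 := by
    refine LinearMap.ext fun w => ?_
    have := crossAdj_cross a w
    rw [ha, one_smul] at this
    exact this
  have h2 := congrArg LinearMap.det h1
  rw [map_mul, map_one] at h2
  have h3 : a ≠ 0 := by
    rintro rfl
    simp at ha
  exact pos_of_mul_pos_left (h2 ▸ one_pos) (det_cross_pos h3).le

/-! ### Conjugacy of the complex structures defined by planes. -/

/-- `J` and `J'` are conjugate by an orientation preserving map. -/
def PositivelyConjugate (J J' : R8 →L[ℝ] R8) : Prop :=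
  ∃ g : R8 →ₗ[ℝ] R8, 0 < LinearMap.det g ∧ ∀ w, g (J' w) = J (g w)

lemma PositivelyConjugate.trans {J J' J'' : R8 →L[ℝ] R8} (h : PositivelyConjugate J J')
    (h' : PositivelyConjugate J' J'') : PositivelyConjugate J J'' := by
  obtain ⟨g, hg, h⟩ := h
  obtain ⟨g', hg', h'⟩ := h'
  refine ⟨g * g', by rw [map_mul]; exact mul_pos hg hg', fun w => ?_⟩
  rw [Module.End.mul_apply, Module.End.mul_apply, h', h]

lemma spinPair_swap {a b : R8} (hab : ⟪a, b⟫_ℝ = 0) (w : R8) :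
    spinPair b a w = -spinPair a b w := by
  have := spinPair_add_swap a b w
  rw [hab, mul_zero, zero_smul] at this
  exact eq_neg_of_add_eq_zero_right this

lemma spinPair_spinPair {a b : R8} (ha : ⟪a, a⟫_ℝ = 1) (hb : ⟪b, b⟫_ℝ = 1) (hab : ⟪a, b⟫_ℝ = 0)
    (w : R8) : spinPair a b (spinPair a b w) = -w := by
  rw [← neg_neg (spinPair a b (spinPair a b w)), ← spinPair_swap hab, spinPair_comp, ha,
    spinPair_self, hb]
  simp

/-- For complex structures `J` and `J'` the map `g = 1 - J J'` satisfies `g J' = J + J' = J g`. Here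
it factors as `crossAdj a ∘ cross (a + a')`, and both factors have positive determinant. -/
lemma positivelyConjugate_left {a a' b : R8} (ha : ⟪a, a⟫_ℝ = 1) (ha' : ⟪a', a'⟫_ℝ = 1)
    (hb : ⟪b, b⟫_ℝ = 1) (hab : ⟪a, b⟫_ℝ = 0) (hab' : ⟪a', b⟫_ℝ = 0) (haa' : ⟪a, a'⟫_ℝ = 0) :
    PositivelyConjugate (spinPair a b) (spinPair a' b) := by
  refine ⟨(crossAdj a : R8 →ₗ[ℝ] R8) * (cross (a + a') : R8 →ₗ[ℝ] R8), ?_, fun w => ?_⟩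
  · rw [map_mul]
    refine mul_pos (det_crossAdj_pos ha) (det_cross_pos fun h => ?_)
    have : ⟪a, a + a'⟫_ℝ = 0 := by rw [h, inner_zero_right]
    rw [inner_add_right, ha, haa'] at this
    norm_num at this
  · have key (z : R8) : ((crossAdj a : R8 →ₗ[ℝ] R8) * (cross (a + a') : R8 →ₗ[ℝ] R8)) z =
        z - spinPair a b (spinPair a' b z) := by
      rw [Module.End.mul_apply, ContinuousLinearMap.coe_coe, ContinuousLinearMap.coe_coe,
        ← neg_neg (spinPair a' b z), ← spinPair_swap hab', map_neg, spinPair_comp, hb, map_add,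
        add_apply, map_add, crossAdj_cross, ha, spinPair_eq]
      module
    rw [key, key, spinPair_spinPair ha' hb hab', map_sub, spinPair_spinPair ha hb hab, map_neg]
    abel

lemma positivelyConjugate_right {a b b' : R8} (ha : ⟪a, a⟫_ℝ = 1) (hb : ⟪b, b⟫_ℝ = 1)
    (hb' : ⟪b', b'⟫_ℝ = 1) (hab : ⟪a, b⟫_ℝ = 0) (hab' : ⟪a, b'⟫_ℝ = 0) (hbb' : ⟪b, b'⟫_ℝ = 0) :
    PositivelyConjugate (spinPair a b) (spinPair a b') := by
  obtain ⟨g, hg, h⟩ := positivelyConjugate_left hb hb' ha (real_inner_comm a b ▸ hab)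
    (real_inner_comm a b' ▸ hab') hbb'
  refine ⟨g, hg, fun w => ?_⟩
  rw [← neg_inj, ← map_neg, ← spinPair_swap hab', ← spinPair_swap hab, h]

lemma exists_unit_orthogonal (s : Finset R8) (hs : s.card < 8) :
    ∃ c : R8, ⟪c, c⟫_ℝ = 1 ∧ ∀ u ∈ s, ⟪u, c⟫_ℝ = 0 := by
  have h1 : Submodule.span ℝ (s : Set R8) ≠ ⊤ := by
    intro h
    have h2 := finrank_span_finset_le_card (R := ℝ) s
    rw [Set.finrank, h, finrank_top, finrank_euclideanSpace_fin] at h2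
    omega
  have h2 : (Submodule.span ℝ (s : Set R8))ᗮ ≠ ⊥ := fun h => h1 (Submodule.orthogonal_eq_bot_iff.1 h)
  obtain ⟨d, hd, hd0⟩ := Submodule.exists_mem_ne_zero_of_ne_bot h2
  have hn : ‖d‖ ≠ 0 := norm_ne_zero_iff.2 hd0
  refine ⟨‖d‖⁻¹ • d, ?_, fun u hu => ?_⟩
  · rw [inner_smul_left, inner_smul_right, real_inner_self_eq_norm_sq]
    simp only [conj_trivial]
    field_simp
  · rw [inner_smul_right, (Submodule.mem_orthogonal _ _).1 hd u (Submodule.subset_span hu), mul_zero]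

-- The pair `a, b` is moved to `ebar 0, ebar 1` one vector at a time, each replacement being
-- orthogonal to the vector it replaces. The auxiliary `c` and `d` are orthogonal to all given
-- vectors, so every intermediate pair is orthonormal; `cross (ebar 1)` is the operator of the pair
-- `ebar 0, ebar 1`.
open Classical in
lemma positivelyConjugate_cross {a b : R8} (h : Orthonormal ℝ ![a, b]) :
    PositivelyConjugate (spinPair a b) (cross (ebar 1)) := by
  obtain ⟨ha, hb, hab⟩ := orthonormal_pair_iff.1 h
  obtain ⟨c, hc, hc'⟩ := exists_unit_orthogonal {a, b, ebar 0, ebar 1}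
    (Finset.card_le_four.trans_lt (by norm_num))
  obtain ⟨d, hd, hd'⟩ := exists_unit_orthogonal {a, b, ebar 0, ebar 1, c}
    (Finset.card_le_five.trans_lt (by norm_num))
  simp only [Finset.mem_insert, Finset.mem_singleton, forall_eq_or_imp, forall_eq] at hc' hd'
  obtain ⟨hac, hbc, h0c, h1c⟩ := hc'
  obtain ⟨had, hbd, h0d, h1d, hcd⟩ := hd'
  have h0 := ebar_zero_inner_self
  have h1 : ⟪ebar 1, ebar 1⟫_ℝ = 1 := by rw [inner_ebar_ebar, if_pos rfl]
  have h01 : ⟪ebar 0, ebar 1⟫_ℝ = 0 := by simp [inner_ebar_ebar]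
  have e : cross (ebar 1) = spinPair (ebar 0) (ebar 1) := by
    refine ContinuousLinearMap.ext fun w => ?_
    rw [spinPair_apply, cross_ebar_zero_left, h0]
    module
  have hcb := hbc
  have hc0 := h0c
  have hd1 := h1d
  rw [real_inner_comm] at hcb hc0 hd1
  rw [e]
  exact (positivelyConjugate_left ha hc hb hab hcb hac).trans <|
    (positivelyConjugate_right hc hb hd hcb hcd hbd).trans <|
    (positivelyConjugate_left hc h0 hd hcd h0d hc0).trans <|
    positivelyConjugate_right h0 hd h1 h0d h01 hd1

/-! ### Determinants of adapted frames. -/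

lemma linearIndependent_frame {v : R8} (hv : v ∈ S6) {w₀ w₁ w₂ w₃ w₄ w₅ : tangent v}
    (h : LinearIndependent ℝ ![w₀, w₁, w₂, w₃, w₄, w₅]) :
    LinearIndependent ℝ ![ebar 0, v, (w₀ : R8), (w₁ : R8), (w₂ : R8), (w₃ : R8), (w₄ : R8),
      (w₅ : R8)] := by
  rw [Fintype.linearIndependent_iff] at h ⊢
  intro g hg
  simp only [Fin.sum_univ_eight, Matrix.cons_val] at hg
  have hw (w : tangent v) := mem_tangent.1 w.2
  have hv0 : ⟪v, ebar 0⟫_ℝ = 0 := by rw [real_inner_comm]; exact hv.2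
  have h0 := congrArg (fun z => ⟪ebar 0, z⟫_ℝ) hg
  have h1 := congrArg (fun z => ⟪v, z⟫_ℝ) hg
  simp only [inner_add_right, inner_smul_right, (hw _).1, (hw _).2, ebar_zero_inner_self, hv.2,
    hv0, S6_inner_self hv, inner_zero_right, mul_zero, mul_one, add_zero, zero_add] at h0 h1
  have h2 := h ![g 2, g 3, g 4, g 5, g 6, g 7] (Subtype.ext (by
    rw [h0, h1, zero_smul, zero_smul, zero_add, zero_add] at hg
    simpa only [Fin.sum_univ_six, Matrix.cons_val, Submodule.coe_add, Submodule.coe_smul,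
      Submodule.coe_zero] using hg))
  intro i
  fin_cases i
  exacts [h0, h1, h2 0, h2 1, h2 2, h2 3, h2 4, h2 5]

/-- A linear map with prescribed values on the standard basis. -/
lemma exists_clm_ebar (F : Fin 8 → R8) : ∃ T : R8 →L[ℝ] R8, (∀ i, T (ebar i) = F i) ∧
    (EuclideanSpace.basisFun (Fin 8) ℝ).toBasis.det F = LinearMap.det (T : R8 →ₗ[ℝ] R8) := by
  set B := (EuclideanSpace.basisFun (Fin 8) ℝ).toBasis with hB
  refine ⟨LinearMap.toContinuousLinearMap (B.constr ℝ F), fun i => ?_, ?_⟩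
  · have := B.constr_basis ℝ F i
    rwa [hB, OrthonormalBasis.coe_toBasis] at this
  · have h1 : F = B.constr ℝ F ∘ B := funext fun i => (B.constr_basis ℝ F i).symm
    conv_lhs => rw [h1]
    rw [Module.Basis.det_comp, B.det_self, mul_one, LinearMap.coe_toContinuousLinearMap]

lemma cross_ebar_1_even (i : Fin 8) (h : i = 2 ∨ i = 4 ∨ i = 6) :
    cross (ebar 1) (ebar i) = ebar (i + 1) := by
  rcases h with rfl | rfl | rfl <;> ext k <;> fin_cases k <;> simp [cross_apply, crossFun, ebar]

/-- The standard basis is adapted to `cross (ebar 1)` in the same way as `F` is to `J`, including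
the sign at the first pair. So the map `T` from the basis to `F` intertwines the two structures, as
does the conjugating map `g`. Then `g⁻¹ T` is complex linear and has nonnegative determinant. -/
lemma det_adapted_frame_pos {J : R8 →L[ℝ] R8} (hJ : ∀ w, J (J w) = -w)
    (hpos : PositivelyConjugate J (cross (ebar 1))) {F : Fin 8 → R8} (hF : LinearIndependent ℝ F)
    (h0 : J (F 0) = -F 1) (h2 : J (F 2) = F 3) (h4 : J (F 4) = F 5) (h6 : J (F 6) = F 7) :
    0 < (EuclideanSpace.basisFun (Fin 8) ℝ).toBasis.det F := by
  obtain ⟨T, hT, hdet⟩ := exists_clm_ebar F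
  have hne : LinearMap.det (T : R8 →ₗ[ℝ] R8) ≠ 0 := by
    rw [← hdet]
    exact ((Module.Basis.is_basis_iff_det _).1 ⟨hF, hF.span_eq_top_of_card_eq_finrank' (by simp)⟩).ne_zero
  have hc (w : R8) : cross (ebar 1) (cross (ebar 1) w) = -w := by
    rw [cross_cross_self (by simp [inner_ebar_ebar]), inner_ebar_ebar, if_pos rfl, neg_one_smul]
  have hTJ : T ∘L cross (ebar 1) = J ∘L T := by
    have e0 : T (cross (ebar 1) (ebar 0)) = J (T (ebar 0)) := by
      rw [cross_ebar_zero_right, map_neg, hT, hT, h0]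
    have e2 : T (cross (ebar 1) (ebar 2)) = J (T (ebar 2)) := by
      rw [cross_ebar_1_even _ (by decide), hT, hT, h2]; rfl
    have e4 : T (cross (ebar 1) (ebar 4)) = J (T (ebar 4)) := by
      rw [cross_ebar_1_even _ (by decide), hT, hT, h4]; rfl
    have e6 : T (cross (ebar 1) (ebar 6)) = J (T (ebar 6)) := by
      rw [cross_ebar_1_even _ (by decide), hT, hT, h6]; rfl
    have step {z : R8} (h : T (cross (ebar 1) z) = J (T z)) :
        T (cross (ebar 1) (cross (ebar 1) z)) = J (T (cross (ebar 1) z)) := by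
      rw [hc, h, hJ, map_neg]
    have e1 := step (z := -ebar 0) (by rw [map_neg, map_neg, e0, map_neg, map_neg])
    rw [map_neg, cross_ebar_zero_right, neg_neg] at e1
    have e3 := step e2
    have e5 := step e4
    have e7 := step e6
    rw [cross_ebar_1_even _ (by decide)] at e3 e5 e7
    refine clm_ext_ebar fun i => ?_
    fin_cases i
    exacts [e0, e1, e2, e3, e4, e5, e6, e7]
  obtain ⟨g, hg, hgJ⟩ := hpos
  obtain ⟨g', hg'⟩ := (LinearMap.isUnit_iff_isUnit_det g).2 hg.ne'.isUnit
  have hcomm : 0 ≤ LinearMap.det ((↑g'⁻¹ : Module.End ℝ R8) * (T : R8 →ₗ[ℝ] R8)) := by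
    refine det_nonneg_of_commute (J := (cross (ebar 1) : R8 →ₗ[ℝ] R8)) (LinearMap.ext hc) ?_
    have h1 : (T : R8 →ₗ[ℝ] R8) * (cross (ebar 1) : R8 →ₗ[ℝ] R8) =
        (J : R8 →ₗ[ℝ] R8) * (T : R8 →ₗ[ℝ] R8) :=
      LinearMap.ext fun w => congrArg (fun S : R8 →L[ℝ] R8 => S w) hTJ
    have h2 : (g' : Module.End ℝ R8) * (cross (ebar 1) : R8 →ₗ[ℝ] R8) =
        (J : R8 →ₗ[ℝ] R8) * (g' : Module.End ℝ R8) := by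
      rw [hg']
      exact LinearMap.ext hgJ
    rw [mul_assoc, h1, ← mul_assoc, ← mul_assoc]
    congr 1
    rw [Units.inv_mul_eq_iff_eq_mul, ← mul_assoc, h2, mul_assoc, Units.mul_inv, mul_one]
  have h3 : (T : R8 →ₗ[ℝ] R8) =
      (g' : Module.End ℝ R8) * ((↑g'⁻¹ : Module.End ℝ R8) * (T : R8 →ₗ[ℝ] R8)) := by
    rw [← mul_assoc, Units.mul_inv, one_mul]
  rw [hdet]
  refine lt_of_le_of_ne' ?_ hne
  rw [h3, map_mul, hg']
  exact mul_nonneg hg.le hcomm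

/-- The orientation defined by an operator that is positively conjugate to `cross (ebar 1)`. -/
lemma det_adapted_frame_pos' {J : R8 →L[ℝ] R8} (hJ : ∀ w, J (J w) = -w)
    (hpos : PositivelyConjugate J (cross (ebar 1))) {u₀ u₁ u₂ u₃ u₄ u₅ u₆ u₇ : R8}
    (hF : LinearIndependent ℝ ![u₀, u₁, u₂, u₃, u₄, u₅, u₆, u₇])
    (h0 : J u₀ = -u₁) (h2 : J u₂ = u₃) (h4 : J u₄ = u₅) (h6 : J u₆ = u₇) :
    0 < (EuclideanSpace.basisFun (Fin 8) ℝ).toBasis.det ![u₀, u₁, u₂, u₃, u₄, u₅, u₆, u₇] :=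
  det_adapted_frame_pos hJ hpos hF h0 h2 h4 h6

lemma positivelyConjugate_spinLin {x : R8 →L[ℝ] R8} (hx : x ∈ G28) :
    PositivelyConjugate (spinLin x) (cross (ebar 1)) := by
  obtain ⟨a, b, h, rfl⟩ := hx
  have h1 : spinLin (wedge a b) = spinPair a b :=
    ContinuousLinearMap.ext fun w => spinLin_wedge a b w (orthonormal_pair_iff.1 h).2.2
  rw [h1]
  exact positivelyConjugate_cross h

lemma inducesOrientation_onTangent {x : R8 →L[ℝ] R8} (hx : x ∈ G28) :
    InducesOrientation (onTangent (tau x) (spinLin x)) := by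
  intro w hw
  have hj := coe_onTangent_spinLin hx
  have hli := linearIndependent_frame (tau_mem_S6 hx) hw
  exact det_adapted_frame_pos' (spinLin_spinLin hx) (positivelyConjugate_spinLin hx)
    hli (spinLin_ebar_zero hx) (hj _).symm (hj _).symm (hj _).symm

/-! ### Planes with prescribed complex structure -/

/-- Two commuting involutions have a common fixed vector, if each can be reversed. -/
lemma exists_fixed_of_involutions {V : Type*} [AddCommGroup V] [Nontrivial V]
    {Q₁ Q₂ S₁ S₂ : V →+ V} (h₁ : ∀ a, Q₁ (Q₁ a) = a) (h₂ : ∀ a, Q₂ (Q₂ a) = a)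
    (h₁₂ : ∀ a, Q₁ (Q₂ a) = Q₂ (Q₁ a)) (hS₁ : ∀ a, S₁ (Q₁ a) = -Q₁ (S₁ a))
    (hS₂ : ∀ a, S₂ (Q₂ a) = -Q₂ (S₂ a)) (hS₂' : ∀ a, S₂ (Q₁ a) = Q₁ (S₂ a))
    (hi₁ : ∀ a, S₁ a = 0 → a = 0) (hi₂ : ∀ a, S₂ a = 0 → a = 0) :
    ∃ a : V, a ≠ 0 ∧ Q₁ a = a ∧ Q₂ a = a := by
  obtain ⟨b, hb, hb₁⟩ : ∃ b : V, b ≠ 0 ∧ Q₁ b = b := by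
    obtain ⟨a, ha⟩ := exists_ne (0 : V)
    -- Either the projection of `a` to the fixed vectors is nonzero, or `Q₁ a = -a` and `S₁` turns
    -- `a` into a fixed vector.
    by_cases h : a + Q₁ a = 0
    · refine ⟨S₁ a, fun h' => ha (hi₁ a h'), ?_⟩
      rw [← neg_neg (Q₁ (S₁ a)), ← hS₁, eq_neg_of_add_eq_zero_right h, map_neg, neg_neg]
    · exact ⟨_, h, by rw [map_add, h₁, add_comm]⟩
  by_cases h : b + Q₂ b = 0
  · refine ⟨S₂ b, fun h' => hb (hi₂ b h'), by rw [← hS₂', hb₁], ?_⟩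
    rw [← neg_neg (Q₂ (S₂ b)), ← hS₂, eq_neg_of_add_eq_zero_right h, map_neg, neg_neg]
  · exact ⟨_, h, by rw [map_add, h₁₂, hb₁], by rw [map_add, h₂, add_comm]⟩

lemma cplx_swap {v w : R8} (hv : ⟪ebar 0, v⟫_ℝ = 0) (hw : ⟪ebar 0, w⟫_ℝ = 0)
    (hvw : ⟪v, w⟫_ℝ = 0) (a : R8) : cplx w (cplx v a) = -cplx v (cplx w a) := by
  have := cplx_add_swap hv hw a
  rw [hvw, mul_zero, zero_smul] at this
  exact eq_neg_of_add_eq_zero_right this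

lemma cplx_cplx_of_unit {v : R8} (hv : ⟪ebar 0, v⟫_ℝ = 0) (h : ⟪v, v⟫_ℝ = 1) (a : R8) :
    cplx v (cplx v a) = -a := by
  rw [cplx_cplx hv, h, neg_one_smul]

-- For `x = a ∧ cplx v a`, a solution of `cplx u (cplx w (cplx v a)) = a` with a unit vector `u ⊥
-- ebar 0` gives `spinLin x w = u`. The triple products for the two pairs are commuting involutions.
-- `cplx w₂` anticommutes with the first; `cplx w₁` anticommutes with the second and commutes with
-- the first, so a common fixed vector exists.
set_option linter.unusedSimpArgs false in
lemma exists_plane_of_pairs {v w₁ u₁ w₂ u₂ : R8}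
    (h : Orthonormal ℝ ![ebar 0, v, w₁, u₁, w₂, u₂]) :
    ∃ x ∈ G28, tau x = v ∧ spinLin x w₁ = u₁ ∧ spinLin x w₂ = u₂ := by
  have ho := orthonormal_iff_ite.1 h
  have hv : ⟪ebar 0, v⟫_ℝ = 0 := ho 0 1
  have hw₁ : ⟪ebar 0, w₁⟫_ℝ = 0 := ho 0 2
  have hu₁ : ⟪ebar 0, u₁⟫_ℝ = 0 := ho 0 3
  have hw₂ : ⟪ebar 0, w₂⟫_ℝ = 0 := ho 0 4
  have hu₂ : ⟪ebar 0, u₂⟫_ℝ = 0 := ho 0 5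
  have r1 := cplx_swap hv hw₁ (ho 1 2)
  have r2 := cplx_swap hv hu₁ (ho 1 3)
  have r3 := cplx_swap hv hw₂ (ho 1 4)
  have r4 := cplx_swap hv hu₂ (ho 1 5)
  have r5 := cplx_swap hw₁ hu₁ (ho 2 3)
  have r6 := cplx_swap hw₁ hw₂ (ho 2 4)
  have r7 := cplx_swap hw₁ hu₂ (ho 2 5)
  have r8 := cplx_swap hu₁ hw₂ (ho 3 4)
  have r9 := cplx_swap hu₁ hu₂ (ho 3 5)
  have r10 := cplx_swap hw₂ hu₂ (ho 4 5)
  have q1 := cplx_cplx_of_unit hv (ho 1 1)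
  have q2 := cplx_cplx_of_unit hw₁ (ho 2 2)
  have q3 := cplx_cplx_of_unit hu₁ (ho 3 3)
  have q4 := cplx_cplx_of_unit hw₂ (ho 4 4)
  have q5 := cplx_cplx_of_unit hu₂ (ho 5 5)
  have hvS : v ∈ S6 := ⟨h.1 1, hv⟩
  obtain ⟨b, hb, hb₁, hb₂⟩ : ∃ b : R8, b ≠ 0 ∧ cplx u₁ (cplx w₁ (cplx v b)) = b ∧
      cplx u₂ (cplx w₂ (cplx v b)) = b := by
    refine exists_fixed_of_involutions
      (Q₁ := (cplx u₁ ∘L cplx w₁ ∘L cplx v : R8 →+ R8))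
      (Q₂ := (cplx u₂ ∘L cplx w₂ ∘L cplx v : R8 →+ R8))
      (S₁ := (cplx w₂ : R8 →+ R8)) (S₂ := (cplx w₁ : R8 →+ R8))
      ?_ ?_ ?_ ?_ ?_ ?_ (fun a ha => ?_) (fun a ha => ?_)
    iterate 6
      · intro a
        simp only [AddMonoidHom.coe_coe, ContinuousLinearMap.comp_apply, r1, r2, r3, r4, r5, r6,
          r7, r8, r9, r10, q1, q2, q3, q4, q5, map_neg, neg_neg]
    · rw [← neg_eq_zero, ← q4]
      exact (congrArg (cplx w₂) ha).trans (map_zero _)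
    · rw [← neg_eq_zero, ← q2]
      exact (congrArg (cplx w₁) ha).trans (map_zero _)
  have hn : ‖b‖ ≠ 0 := norm_ne_zero_iff.2 hb
  obtain ⟨a, ha, ha₁, ha₂⟩ : ∃ a : R8, ⟪a, a⟫_ℝ = 1 ∧ cplx u₁ (cplx w₁ (cplx v a)) = a ∧
      cplx u₂ (cplx w₂ (cplx v a)) = a := by
    refine ⟨‖b‖⁻¹ • b, ?_, by simp only [map_smul, hb₁], by simp only [map_smul, hb₂]⟩
    rw [inner_smul_left, inner_smul_right, real_inner_self_eq_norm_sq]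
    simp only [conj_trivial]
    field_simp
  obtain ⟨hx, hτ⟩ := (mem_fibre_iff hvS _).2 ⟨a, ha, rfl⟩
  have key {w u : R8} (hq : ∀ a, cplx u (cplx u a) = -a) (hwu : cplx u (cplx w (cplx v a)) = a) :
      spinLin (wedge a (cplx v a)) w = u := by
    have h1 := congrArg (cplx u) hwu
    rw [hq, cplx_apply u a, neg_inj, cplx_apply w, neg_eq_iff_eq_neg] at h1
    rw [spinLin_wedge _ _ _ (orthonormal_pair_iff.1 (orthonormal_cplx hvS ha)).2.2, spinPair_eq,
      h1, map_neg, neg_neg, crossAdj_cross, ha, one_smul]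
  exact ⟨_, hx, hτ, key q3 ha₁, key q5 ha₂⟩

/-! ### Adapted frames -/

lemma orthonormal_cons {n : ℕ} {F : Fin n → R8} {a : R8} (ha : ⟪a, a⟫_ℝ = 1)
    (h : ∀ i, ⟪a, F i⟫_ℝ = 0) (hF : Orthonormal ℝ F) : Orthonormal ℝ (Matrix.vecCons a F) := by
  rw [orthonormal_iff_ite] at hF ⊢
  intro i k
  refine Fin.cases ?_ (fun i => ?_) i <;> refine Fin.cases ?_ (fun k => ?_) k
  · simpa using ha
  · simpa [(Fin.succ_ne_zero k).symm] using h k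
  · rw [real_inner_comm]
    simpa [Fin.succ_ne_zero i] using h i
  · simpa using hF i k

lemma clm_ext_orthonormal {F : Fin 8 → R8} (hF : Orthonormal ℝ F) {T T' : R8 →L[ℝ] R8}
    (h : ∀ i, T (F i) = T' (F i)) : T = T' := by
  have hs := hF.linearIndependent.span_eq_top_of_card_eq_finrank' (by simp)
  refine ContinuousLinearMap.ext_on (s := Set.range F) ?_ ?_
  · rw [hs]
    exact dense_univ
  · rintro _ ⟨i, rfl⟩
    exact h i

lemma clm_ext_frame {u₀ u₁ u₂ u₃ u₄ u₅ u₆ u₇ : R8}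
    (hF : Orthonormal ℝ ![u₀, u₁, u₂, u₃, u₄, u₅, u₆, u₇]) {T T' : R8 →L[ℝ] R8}
    (h₀ : T u₀ = T' u₀) (h₁ : T u₁ = T' u₁) (h₂ : T u₂ = T' u₂) (h₃ : T u₃ = T' u₃)
    (h₄ : T u₄ = T' u₄) (h₅ : T u₅ = T' u₅) (h₆ : T u₆ = T' u₆) (h₇ : T u₇ = T' u₇) : T = T' := by
  refine clm_ext_orthonormal hF fun i => ?_
  fin_cases i
  exacts [h₀, h₁, h₂, h₃, h₄, h₅, h₆, h₇]

lemma eq_zero_of_orthogonal {F : Fin 8 → R8} (hF : Orthonormal ℝ F) {z : R8}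
    (h : ∀ i, ⟪z, F i⟫_ℝ = 0) : z = 0 := by
  have h1 : (innerSL ℝ z).smulRight (ebar 0) = (0 : R8 →L[ℝ] R8) :=
    clm_ext_orthonormal hF fun i => by simp [h i]
  have h2 := congrArg (fun S : R8 →L[ℝ] R8 => ⟪S z, ebar 0⟫_ℝ) h1
  simpa [inner_smul_left, ebar_zero_inner_self, norm_ebar] using h2

section

variable {v : R8} {j : tangent v →L[ℝ] tangent v}

lemma extend_ebar_zero (hv : v ∈ S6) : extend j (ebar 0) = 0 := by
  have h : (tangent v).orthogonalProjectionOnto (ebar 0) = 0 := Subtype.ext (by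
    rw [coe_projection_tangent hv, ebar_zero_inner_self, real_inner_comm, hv.2]
    simp)
  rw [extend_apply, h, map_zero, Submodule.coe_zero]

lemma extend_base (hv : v ∈ S6) : extend j v = 0 := by
  have h : (tangent v).orthogonalProjectionOnto v = 0 := Subtype.ext (by
    rw [coe_projection_tangent hv, hv.2, S6_inner_self hv]
    simp)
  rw [extend_apply, h, map_zero, Submodule.coe_zero]

lemma IsOrthogonalComplexStructure.inner_swap (hj : IsOrthogonalComplexStructure j)
    (w w' : tangent v) : ⟪(j w : R8), (w' : R8)⟫_ℝ = -⟪(w : R8), (j w' : R8)⟫_ℝ := by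
  have h := hj.2 (j w) w'
  rw [hj.1, inner_neg_left] at h
  exact h.symm

lemma IsOrthogonalComplexStructure.inner_self (hj : IsOrthogonalComplexStructure j)
    (w : tangent v) : ⟪(w : R8), (j w : R8)⟫_ℝ = 0 := by
  have h := hj.inner_swap w w
  rw [real_inner_comm] at h
  linarith

lemma IsOrthogonalComplexStructure.exists_frame (hv : v ∈ S6)
    (hj : IsOrthogonalComplexStructure j) : ∃ w₁ w₂ w₃ : tangent v,
      Orthonormal ℝ ![ebar 0, v, (w₁ : R8), (j w₁ : R8), (w₂ : R8), (j w₂ : R8), (w₃ : R8),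
        (j w₃ : R8)] := by
  classical
  obtain ⟨c₁, n₁, o₁⟩ := exists_unit_orthogonal {ebar 0, v}
    (Finset.card_le_two.trans_lt (by norm_num))
  simp only [Finset.mem_insert, Finset.mem_singleton, forall_eq_or_imp, forall_eq] at o₁
  obtain ⟨w₁, rfl⟩ : ∃ w : tangent v, (w : R8) = c₁ := ⟨⟨c₁, mem_tangent.2 o₁⟩, rfl⟩
  obtain ⟨c₂, n₂, o₂⟩ := exists_unit_orthogonal {ebar 0, v, (w₁ : R8), (j w₁ : R8)}
    (Finset.card_le_four.trans_lt (by norm_num))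
  simp only [Finset.mem_insert, Finset.mem_singleton, forall_eq_or_imp, forall_eq] at o₂
  obtain ⟨w₂, rfl⟩ : ∃ w : tangent v, (w : R8) = c₂ := ⟨⟨c₂, mem_tangent.2 ⟨o₂.1, o₂.2.1⟩⟩, rfl⟩
  obtain ⟨c₃, n₃, o₃⟩ := exists_unit_orthogonal
    {ebar 0, v, (w₁ : R8), (j w₁ : R8), (w₂ : R8), (j w₂ : R8)}
    (Finset.card_le_six.trans_lt (by norm_num))
  simp only [Finset.mem_insert, Finset.mem_singleton, forall_eq_or_imp, forall_eq] at o₃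
  obtain ⟨w₃, rfl⟩ : ∃ w : tangent v, (w : R8) = c₃ := ⟨⟨c₃, mem_tangent.2 ⟨o₃.1, o₃.2.1⟩⟩, rfl⟩
  have ht (w : tangent v) := mem_tangent.1 w.2
  have hn (w : tangent v) : ⟪(j w : R8), (j w : R8)⟫_ℝ = ⟪(w : R8), (w : R8)⟫_ℝ := hj.2 w w
  have hjj (w w' : tangent v) : ⟪(j w : R8), (j w' : R8)⟫_ℝ = ⟪(w : R8), (w' : R8)⟫_ℝ := hj.2 w w'
  have hs (w w' : tangent v) (h : ⟪(j w : R8), (w' : R8)⟫_ℝ = 0) :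
      ⟪(w : R8), (j w' : R8)⟫_ℝ = 0 := by
    have := hj.inner_swap w w'
    linarith
  obtain ⟨-, -, a₁, a₂⟩ := o₂
  obtain ⟨-, -, b₁, b₂, b₃, b₄⟩ := o₃
  refine ⟨w₁, w₂, w₃, ?_⟩
  refine orthonormal_cons ebar_zero_inner_self ?_ <| orthonormal_cons (S6_inner_self hv) ?_ <|
    orthonormal_cons n₁ ?_ <| orthonormal_cons (by rw [hn, n₁]) ?_ <|
    orthonormal_cons n₂ ?_ <| orthonormal_cons (by rw [hn, n₂]) ?_ <|
    orthonormal_cons n₃ ?_ <| orthonormal_cons (by rw [hn, n₃]) ?_ ?_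
  · simp [Fin.forall_fin_succ, hv.2, (ht _).1]
  · simp [Fin.forall_fin_succ, (ht _).2]
  · simp [Fin.forall_fin_succ, hj.inner_self, a₁, hs _ _ a₂, b₁, hs _ _ b₂]
  · simp [Fin.forall_fin_succ, hjj, a₁, a₂, b₁, b₂]
  · simp [Fin.forall_fin_succ, hj.inner_self, b₃, hs _ _ b₄]
  · simp [Fin.forall_fin_succ, hjj, b₃, b₄]
  · simp [hj.inner_self]
  · simp
  · exact ⟨fun i => i.elim0, fun i => i.elim0⟩

/-- The sign of a complex structure, from the determinant of a single adapted frame. -/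
def frameDet (j : tangent v →L[ℝ] tangent v) (w₁ w₂ w₃ : tangent v) : ℝ :=
  (EuclideanSpace.basisFun (Fin 8) ℝ).toBasis.det ![ebar 0, v, (w₁ : R8), (j w₁ : R8), (w₂ : R8),
    (j w₂ : R8), (w₃ : R8), (j w₃ : R8)]

lemma det_scaled_frame (u₀ u₁ u₂ u₃ u₄ u₅ u₆ u₇ : R8) (a b c : ℝ) :
    (EuclideanSpace.basisFun (Fin 8) ℝ).toBasis.det ![u₀, u₁, u₂, a • u₃, u₄, b • u₅, u₆, c • u₇] =
      a * b * c *
        (EuclideanSpace.basisFun (Fin 8) ℝ).toBasis.det ![u₀, u₁, u₂, u₃, u₄, u₅, u₆, u₇] := by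
  have h1 : ![u₀, u₁, u₂, a • u₃, u₄, b • u₅, u₆, c • u₇] = fun i =>
      (![1, 1, 1, a, 1, b, 1, c] : Fin 8 → ℝ) i • ![u₀, u₁, u₂, u₃, u₄, u₅, u₆, u₇] i := by
    funext i
    fin_cases i <;> simp
  have h2 := (EuclideanSpace.basisFun (Fin 8) ℝ).toBasis.det.toMultilinearMap.map_smul_univ
    ![1, 1, 1, a, 1, b, 1, c] ![u₀, u₁, u₂, u₃, u₄, u₅, u₆, u₇]
  rw [h1]
  refine h2.trans ?_
  simp [Fin.prod_univ_eight]

lemma orthonormal_scaled_frame {u₀ u₁ u₂ u₃ u₄ u₅ u₆ u₇ : R8}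
    (h : Orthonormal ℝ ![u₀, u₁, u₂, u₃, u₄, u₅, u₆, u₇]) {a b c : ℝ} (ha : a = 1 ∨ a = -1)
    (hb : b = 1 ∨ b = -1) (hc : c = 1 ∨ c = -1) :
    Orthonormal ℝ ![u₀, u₁, u₂, a • u₃, u₄, b • u₅, u₆, c • u₇] := by
  have h1 : ![u₀, u₁, u₂, a • u₃, u₄, b • u₅, u₆, c • u₇] = fun i =>
      (![1, 1, 1, a, 1, b, 1, c] : Fin 8 → ℝ) i • ![u₀, u₁, u₂, u₃, u₄, u₅, u₆, u₇] i := by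
    funext i
    fin_cases i <;> simp
  have h2 : ∀ i, ‖(![1, 1, 1, a, 1, b, 1, c] : Fin 8 → ℝ) i‖ = 1 := by
    have hn {t : ℝ} (ht : t = 1 ∨ t = -1) : ‖t‖ = 1 := by rcases ht with rfl | rfl <;> simp
    intro i
    fin_cases i <;> simp [hn ha, hn hb, hn hc, -Real.norm_eq_abs]
  rw [h1]
  refine ⟨fun i => ?_, fun i k hik => ?_⟩
  · rw [norm_smul, h2, h.1, one_mul]
  · beta_reduce
    rw [inner_smul_left, inner_smul_right, h.2 hik, mul_zero, mul_zero]

lemma frameDet_neg (j : tangent v →L[ℝ] tangent v) (w₁ w₂ w₃ : tangent v) :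
    frameDet (-j) w₁ w₂ w₃ = -frameDet j w₁ w₂ w₃ := by
  have h (w : tangent v) : ((-j) w : R8) = (-1 : ℝ) • (j w : R8) := by simp
  rw [frameDet, h, h, h, det_scaled_frame, frameDet]
  ring

lemma InducesOrientation.frameDet_pos (h : InducesOrientation j) {w₁ w₂ w₃ : tangent v}
    (hw : Orthonormal ℝ ![ebar 0, v, (w₁ : R8), (j w₁ : R8), (w₂ : R8), (j w₂ : R8), (w₃ : R8),
      (j w₃ : R8)]) : 0 < frameDet j w₁ w₂ w₃ := by
  refine h ![w₁, w₂, w₃] ?_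
  have h1 := hw.linearIndependent.comp (fun i : Fin 6 => i.natAdd 2) (Fin.natAdd_injective _ _)
  refine LinearIndependent.of_comp (tangent v).subtype ?_
  have h2 : (tangent v).subtype ∘ ![w₁, j w₁, w₂, j w₂, w₃, j w₃] =
      ![ebar 0, v, (w₁ : R8), (j w₁ : R8), (w₂ : R8), (j w₂ : R8), (w₃ : R8), (j w₃ : R8)] ∘
        fun i : Fin 6 => i.natAdd 2 := by
    funext i
    fin_cases i <;> rfl
  exact h2 ▸ h1

/-- The complex dimension of `tangent v` is three, so `-j` changes the determinant of an adapted
frame by `(-1)³`. -/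
lemma InducesOrientation.not_neg (hv : v ∈ S6) (hj : IsOrthogonalComplexStructure j)
    (h : InducesOrientation j) : ¬InducesOrientation (-j) := by
  intro h'
  obtain ⟨w₁, w₂, w₃, hw⟩ := hj.exists_frame hv
  have h1 := h.frameDet_pos hw
  have h2 : 0 < frameDet (-j) w₁ w₂ w₃ := by
    refine h'.frameDet_pos ?_
    have hneg (w : tangent v) : ((-j) w : R8) = (-1 : ℝ) • (j w : R8) := by simp
    rw [hneg, hneg, hneg]
    exact orthonormal_scaled_frame hw (Or.inr rfl) (Or.inr rfl) (Or.inr rfl)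
  rw [frameDet_neg] at h2
  linarith

/-- The operator that agrees with `j` up to signs on the complex lines of an adapted frame. -/
lemma exists_plane_of_frame (hj : IsOrthogonalComplexStructure j) {w₁ w₂ w₃ : tangent v}
    (hw : Orthonormal ℝ ![ebar 0, v, (w₁ : R8), (j w₁ : R8), (w₂ : R8), (j w₂ : R8), (w₃ : R8),
      (j w₃ : R8)]) (ε : ℝ) (hε : ε = 1 ∨ ε = -1) :
    ∃ x ∈ G28, tau x = v ∧ spinLin x w₁ = ε • (j w₁ : R8) ∧ spinLin x w₂ = ε • (j w₂ : R8) ∧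
      ∃ c : ℝ, (c = 1 ∨ c = -1) ∧ spinLin x w₃ = c • (j w₃ : R8) ∧
        0 < c * frameDet j w₁ w₂ w₃ := by
  have ho := orthonormal_iff_ite.1 hw
  have hε1 : ε * ε = 1 := by rcases hε with rfl | rfl <;> norm_num
  have hplane : Orthonormal ℝ ![ebar 0, v, (w₁ : R8), ε • (j w₁ : R8), (w₂ : R8),
      ε • (j w₂ : R8)] := by
    have h1 := (orthonormal_scaled_frame hw hε hε (Or.inl rfl)).comp
      (fun i : Fin 6 => i.castLE (by norm_num : 6 ≤ 8)) (Fin.castLE_injective (by norm_num : 6 ≤ 8))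
    convert h1 using 1
    funext i
    fin_cases i <;> rfl
  obtain ⟨x, hx, rfl, h1, h2⟩ := exists_plane_of_pairs hplane
  refine ⟨x, hx, rfl, h1, h2, ?_⟩
  -- `spinLin x` is skew and permutes the first six frame vectors up to sign, so it maps `w₃` into
  -- the span of `w₃` and `j w₃`; by skewness the component along `w₃` vanishes.
  set c := ⟪(j w₃ : R8), spinLin x w₃⟫_ℝ with hc
  have h3 : spinLin x w₃ = c • (j w₃ : R8) := by
    refine sub_eq_zero.1 (eq_zero_of_orthogonal hw fun i => ?_)
    have hK {w : tangent (tau x)} (h : spinLin x w = ε • (j w : R8)) :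
        spinLin x (j w : R8) = -ε • (w : R8) := by
      have h4 := congrArg (ε • spinLin x ·) h
      simp only [map_smul, spinLin_spinLin hx, smul_smul, hε1, one_smul] at h4
      rw [← h4, smul_neg, neg_smul]
    have hs := inner_spinLin_swap hx (w₃ : R8)
    have o (i k : Fin 8) (hik : i ≠ k) := hw.2 hik
    rw [inner_sub_left, inner_smul_left, conj_trivial]
    fin_cases i
    · change ⟪spinLin x w₃, ebar 0⟫_ℝ - c * ⟪(j w₃ : R8), ebar 0⟫_ℝ = 0
      rw [hs, spinLin_ebar_zero hx, inner_neg_right,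
        show ⟪(w₃ : R8), tau x⟫_ℝ = 0 from o 6 1 (by decide),
        show ⟪(j w₃ : R8), ebar 0⟫_ℝ = 0 from o 7 0 (by decide)]
      ring
    · change ⟪spinLin x w₃, tau x⟫_ℝ - c * ⟪(j w₃ : R8), tau x⟫_ℝ = 0
      rw [hs, spinLin_tau hx, show ⟪(w₃ : R8), ebar 0⟫_ℝ = 0 from o 6 0 (by decide),
        show ⟪(j w₃ : R8), tau x⟫_ℝ = 0 from o 7 1 (by decide)]
      ring
    · change ⟪spinLin x w₃, (w₁ : R8)⟫_ℝ - c * ⟪(j w₃ : R8), (w₁ : R8)⟫_ℝ = 0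
      rw [hs, h1, inner_smul_right, show ⟪(w₃ : R8), (j w₁ : R8)⟫_ℝ = 0 from o 6 3 (by decide),
        show ⟪(j w₃ : R8), (w₁ : R8)⟫_ℝ = 0 from o 7 2 (by decide)]
      ring
    · change ⟪spinLin x w₃, (j w₁ : R8)⟫_ℝ - c * ⟪(j w₃ : R8), (j w₁ : R8)⟫_ℝ = 0
      rw [hs, hK h1, inner_smul_right, show ⟪(w₃ : R8), (w₁ : R8)⟫_ℝ = 0 from o 6 2 (by decide),
        show ⟪(j w₃ : R8), (j w₁ : R8)⟫_ℝ = 0 from o 7 3 (by decide)]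
      ring
    · change ⟪spinLin x w₃, (w₂ : R8)⟫_ℝ - c * ⟪(j w₃ : R8), (w₂ : R8)⟫_ℝ = 0
      rw [hs, h2, inner_smul_right, show ⟪(w₃ : R8), (j w₂ : R8)⟫_ℝ = 0 from o 6 5 (by decide),
        show ⟪(j w₃ : R8), (w₂ : R8)⟫_ℝ = 0 from o 7 4 (by decide)]
      ring
    · change ⟪spinLin x w₃, (j w₂ : R8)⟫_ℝ - c * ⟪(j w₃ : R8), (j w₂ : R8)⟫_ℝ = 0
      rw [hs, hK h2, inner_smul_right, show ⟪(w₃ : R8), (w₂ : R8)⟫_ℝ = 0 from o 6 4 (by decide),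
        show ⟪(j w₃ : R8), (j w₂ : R8)⟫_ℝ = 0 from o 7 5 (by decide)]
      ring
    · change ⟪spinLin x w₃, (w₃ : R8)⟫_ℝ - c * ⟪(j w₃ : R8), (w₃ : R8)⟫_ℝ = 0
      rw [show ⟪(j w₃ : R8), (w₃ : R8)⟫_ℝ = 0 from o 7 6 (by decide)]
      have h5 := hs w₃
      rw [real_inner_comm] at h5
      rw [real_inner_comm]
      linarith
    · change ⟪spinLin x w₃, (j w₃ : R8)⟫_ℝ - c * ⟪(j w₃ : R8), (j w₃ : R8)⟫_ℝ = 0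
      rw [show ⟪(j w₃ : R8), (j w₃ : R8)⟫_ℝ = 1 from ho 7 7, hc, real_inner_comm]
      ring
  have hc1 : c = 1 ∨ c = -1 := by
    have := inner_spinLin hx (w₃ : R8) w₃
    rw [h3, inner_smul_left, inner_smul_right, show ⟪(j w₃ : R8), (j w₃ : R8)⟫_ℝ = 1 from ho 7 7,
      show ⟪(w₃ : R8), (w₃ : R8)⟫_ℝ = 1 from ho 6 6, mul_one, conj_trivial] at this
    exact mul_self_eq_one_iff.1 this
  refine ⟨c, hc1, h3, ?_⟩
  -- The sign `ε` enters the determinant twice and cancels, so the orientation constrains only `c`.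
  have h4 := det_adapted_frame_pos' (spinLin_spinLin hx) (positivelyConjugate_spinLin hx)
    (orthonormal_scaled_frame hw hε hε hc1).linearIndependent (spinLin_ebar_zero hx) h1 h2 h3
  rwa [det_scaled_frame, hε1, one_mul] at h4

/-- Every orthogonal complex structure is, up to sign, that of a plane. -/
lemma IsOrthogonalComplexStructure.exists_plane (hv : v ∈ S6)
    (hj : IsOrthogonalComplexStructure j) :
    ∃ x ∈ G28, tau x = v ∧ (onTangent v (spinLin x) = j ∨ onTangent v (spinLin x) = -j) := by
  obtain ⟨w₁, w₂, w₃, hw⟩ := hj.exists_frame hv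
  -- With `ε` the sign of `frameDet`, the inequality for `c` forces `c = ε`, and the plane realizes
  -- `ε • j` on all three complex lines.
  obtain ⟨ε, hε, hεD⟩ : ∃ ε : ℝ, (ε = 1 ∨ ε = -1) ∧ 0 ≤ ε * frameDet j w₁ w₂ w₃ := by
    rcases le_total 0 (frameDet j w₁ w₂ w₃) with h | h
    · exact ⟨1, Or.inl rfl, by linarith⟩
    · exact ⟨-1, Or.inr rfl, by linarith⟩
  obtain ⟨x, hx, rfl, h1, h2, c, hc, h3, hcD⟩ := exists_plane_of_frame hj hw ε hε
  refine ⟨x, hx, rfl, ?_⟩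
  have hcε : c = ε := by
    rcases hc with rfl | rfl <;> rcases hε with rfl | rfl <;> first | rfl | (exfalso; linarith)
  rw [hcε] at h3
  have hK : spinLin x = ε • extend j + wedge (tau x) (ebar 0) := by
    have hv0 : ⟪tau x, ebar 0⟫_ℝ = 0 := by rw [real_inner_comm]; exact hv.2
    have hwedge (w : tangent (tau x)) : wedge (tau x) (ebar 0) w = 0 := by
      have := mem_tangent.1 w.2
      simp [wedge, this.1, this.2]
    have ht {w : tangent (tau x)} (h : spinLin x w = ε • (j w : R8)) :
        spinLin x w = (ε • extend j + wedge (tau x) (ebar 0)) w := by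
      rw [add_apply, smul_apply, extend_coe, hwedge, add_zero, h]
    have ht' {w : tangent (tau x)} (h : spinLin x w = ε • (j w : R8)) :
        spinLin x (j w : R8) = (ε • extend j + wedge (tau x) (ebar 0)) (j w : R8) := by
      rw [add_apply, smul_apply, extend_coe, hwedge, add_zero, hj.1]
      have h4 := congrArg (ε • spinLin x ·) h
      rcases hε with rfl | rfl <;> simpa [spinLin_spinLin hx, eq_comm] using h4
    refine clm_ext_frame hw ?_ ?_ (ht h1) (ht' h1) (ht h2) (ht' h2) (ht h3) (ht' h3)
    · rw [spinLin_ebar_zero hx, add_apply, smul_apply, extend_ebar_zero hv]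
      simp [wedge, hv0, norm_ebar]
    · rw [spinLin_tau hx, add_apply, smul_apply, extend_base hv]
      simp [wedge, hv.1, hv.2]
  have hT : onTangent (tau x) (spinLin x) = ε • j := by
    refine ContinuousLinearMap.ext fun w => Subtype.ext ?_
    have hw := mem_tangent.1 w.2
    rw [coe_onTangent_spinLin hx, hK]
    simp [extend_coe, wedge, hw.1, hw.2]
  rcases hε with rfl | rfl
  · exact Or.inl (by rw [hT, one_smul])
  · exact Or.inr (hT.trans (by ext1 w; simp))

end

/-! ### The fibres of `τ` are projective spaces -/

lemma exists_cplx_frame {v : R8} (hv : v ∈ S6) : ∃ u₀ u₁ u₂ u₃ : R8,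
    Orthonormal ℝ ![u₀, cplx v u₀, u₁, cplx v u₁, u₂, cplx v u₂, u₃, cplx v u₃] := by
  classical
  obtain ⟨u₀, n₀, -⟩ := exists_unit_orthogonal ∅ (by norm_num)
  obtain ⟨u₁, n₁, o₁⟩ := exists_unit_orthogonal {u₀, cplx v u₀}
    (Finset.card_le_two.trans_lt (by norm_num))
  obtain ⟨u₂, n₂, o₂⟩ := exists_unit_orthogonal {u₀, cplx v u₀, u₁, cplx v u₁}
    (Finset.card_le_four.trans_lt (by norm_num))
  obtain ⟨u₃, n₃, o₃⟩ := exists_unit_orthogonal {u₀, cplx v u₀, u₁, cplx v u₁, u₂, cplx v u₂}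
    (Finset.card_le_six.trans_lt (by norm_num))
  simp only [Finset.mem_insert, Finset.mem_singleton, forall_eq_or_imp, forall_eq] at o₁ o₂ o₃
  obtain ⟨a₁, a₂⟩ := o₁
  obtain ⟨b₁, b₂, b₃, b₄⟩ := o₂
  obtain ⟨c₁, c₂, c₃, c₄, c₅, c₆⟩ := o₃
  have hii (a b : R8) : ⟪cplx v a, cplx v b⟫_ℝ = ⟪a, b⟫_ℝ := by
    rw [inner_cplx, S6_inner_self hv, one_mul]
  have hs (a b : R8) (h : ⟪cplx v a, b⟫_ℝ = 0) : ⟪a, cplx v b⟫_ℝ = 0 := by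
    rw [← neg_eq_zero, ← inner_cplx_swap hv.2, h]
  have hself (a : R8) : ⟪a, cplx v a⟫_ℝ = 0 := by
    have := inner_cplx_swap hv.2 a a
    rw [real_inner_comm] at this
    linarith
  refine ⟨u₀, u₁, u₂, u₃, ?_⟩
  refine orthonormal_cons n₀ ?_ <| orthonormal_cons (by rw [hii, n₀]) ?_ <|
    orthonormal_cons n₁ ?_ <| orthonormal_cons (by rw [hii, n₁]) ?_ <|
    orthonormal_cons n₂ ?_ <| orthonormal_cons (by rw [hii, n₂]) ?_ <|
    orthonormal_cons n₃ ?_ <| orthonormal_cons (by rw [hii, n₃]) ?_ ?_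
  · simp [Fin.forall_fin_succ, hself, a₁, hs _ _ a₂, b₁, hs _ _ b₂, c₁, hs _ _ c₂]
  · simp [Fin.forall_fin_succ, hii, a₁, a₂, b₁, b₂, c₁, c₂]
  · simp [Fin.forall_fin_succ, hself, b₃, hs _ _ b₄, c₃, hs _ _ c₄]
  · simp [Fin.forall_fin_succ, hii, b₃, b₄, c₃, c₄]
  · simp [Fin.forall_fin_succ, hself, c₅, hs _ _ c₆]
  · simp [Fin.forall_fin_succ, hii, c₅, c₆]
  · simp [hself]
  · simp
  · exact ⟨fun i => i.elim0, fun i => i.elim0⟩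

lemma sum_inner_sq_of_orthonormal {F : Fin 8 → R8} (hF : Orthonormal ℝ F) (a : R8) :
    ∑ i, ⟪F i, a⟫_ℝ ^ 2 = ‖a‖ ^ 2 := by
  have h := (OrthonormalBasis.mk hF
    (hF.linearIndependent.span_eq_top_of_card_eq_finrank' (by simp)).ge).sum_sq_norm_inner_right a
  simpa [Real.norm_eq_abs] using h

/-- The space `ℝ⁸` with the complex structure `cplx v` is isometric to `ℂ⁴`. -/
lemma exists_complex_isometry {v : R8} (hv : v ∈ S6) :
    ∃ θ : R8 ≃ₗᵢ[ℝ] EuclideanSpace ℂ (Fin 4), ∀ a, θ (cplx v a) = Complex.I • θ a := by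
  obtain ⟨u₀, u₁, u₂, u₃, hu⟩ := exists_cplx_frame hv
  let u : Fin 4 → R8 := ![u₀, u₁, u₂, u₃]
  let f : R8 →ₗ[ℝ] EuclideanSpace ℂ (Fin 4) :=
    { toFun := fun a => WithLp.toLp 2 fun k => ⟨⟪u k, a⟫_ℝ, ⟪cplx v (u k), a⟫_ℝ⟩
      map_add' := fun a b => by
        ext k
        apply Complex.ext <;> simp [inner_add_right]
      map_smul' := fun c a => by
        ext k
        apply Complex.ext <;> simp [inner_smul_right] }
  have hf (a : R8) (k : Fin 4) : f a k = ⟨⟪u k, a⟫_ℝ, ⟪cplx v (u k), a⟫_ℝ⟩ := rfl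
  let g : R8 →ₗᵢ[ℝ] EuclideanSpace ℂ (Fin 4) :=
    { f with
      norm_map' := fun a => by
        change ‖f a‖ = ‖a‖
        rw [← sq_eq_sq₀ (norm_nonneg _) (norm_nonneg _), EuclideanSpace.norm_sq_eq,
          ← sum_inner_sq_of_orthonormal hu]
        simp only [hf, ← Complex.normSq_eq_norm_sq, Complex.normSq_mk, Fin.sum_univ_eight,
          Fin.sum_univ_four]
        simp [u]
        ring }
  refine ⟨g.toLinearIsometryEquiv ?_, fun a => ?_⟩
  · rw [finrank_euclideanSpace_fin, finrank_real_of_complex, finrank_euclideanSpace_fin]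
  · rw [LinearIsometry.coe_toLinearIsometryEquiv]
    change f (cplx v a) = Complex.I • f a
    ext k
    have h1 := inner_cplx_swap hv.2 (u k) a
    have h2 := inner_cplx v (u k) a
    rw [S6_inner_self hv, one_mul] at h2
    rw [PiLp.smul_apply, hf, hf, h2]
    apply Complex.ext <;> simp [h1]

lemma inner_complex_isometry {v : R8} {θ : R8 ≃ₗᵢ[ℝ] EuclideanSpace ℂ (Fin 4)}
    (hθ : ∀ a, θ (cplx v a) = Complex.I • θ a) (a b : R8) :
    ⟪θ a, θ b⟫_ℂ = ⟨⟪a, b⟫_ℝ, ⟪cplx v a, b⟫_ℝ⟩ := by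
  have h (a : R8) : (⟪θ a, θ b⟫_ℂ).re = ⟪a, b⟫_ℝ := by
    rw [← θ.inner_map_map a b]
    rfl
  apply Complex.ext
  · exact h a
  · rw [← h (cplx v a), hθ, inner_smul_left]
    simp

/-- Composition with fixed operators on both sides. -/
def sandwich {V V' W W' : Type*} [NormedAddCommGroup V] [NormedSpace ℝ V] [NormedAddCommGroup V']
    [NormedSpace ℝ V'] [NormedAddCommGroup W] [NormedSpace ℝ W] [NormedAddCommGroup W']
    [NormedSpace ℝ W'] (A : W →L[ℝ] W') (B : V' →L[ℝ] V) : (V →L[ℝ] W) →ₗ[ℝ] (V' →L[ℝ] W') where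
  toFun x := A ∘L x ∘L B
  map_add' x y := by rw [ContinuousLinearMap.add_comp, ContinuousLinearMap.comp_add]
  map_smul' c x := by
    rw [ContinuousLinearMap.smul_comp, ContinuousLinearMap.comp_smul, RingHom.id_apply]

/-- The fibres of `τ` are linearly equivalent to `CP³`. -/
lemma exists_fibre_model {v : R8} (hv : v ∈ S6) :
    ∃ (L : (R8 →L[ℝ] R8) →L[ℝ] (EuclideanSpace ℂ (Fin 4) →L[ℂ] EuclideanSpace ℂ (Fin 4)))
      (L' : (EuclideanSpace ℂ (Fin 4) →L[ℂ] EuclideanSpace ℂ (Fin 4)) →L[ℝ] (R8 →L[ℝ] R8)),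
      (∀ a : R8, ⟪a, a⟫_ℝ = 1 → L (wedge a (cplx v a)) ∈ CP3 ∧
        L' (L (wedge a (cplx v a))) = wedge a (cplx v a)) ∧
      ∀ P ∈ CP3, ∃ a : R8, ⟪a, a⟫_ℝ = 1 ∧ P = L (wedge a (cplx v a)) := by
  obtain ⟨θ, hθ⟩ := exists_complex_isometry hv
  let E := EuclideanSpace ℂ (Fin 4)
  let θ₁ : R8 →L[ℝ] E := θ.toContinuousLinearEquiv
  let θ₂ : E →L[ℝ] R8 := θ.symm.toContinuousLinearEquiv
  have h12 (z : E) : θ₁ (θ₂ z) = z := θ.apply_symm_apply z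
  have h21 (a : R8) : θ₂ (θ₁ a) = a := θ.symm_apply_apply a
  let R : (E →L[ℂ] E) →ₗ[ℝ] (E →L[ℝ] E) := ContinuousLinearMap.restrictScalarsₗ ℂ E E ℝ ℝ
  have hR : Function.Injective R := fun x y h =>
    ContinuousLinearMap.ext fun z => congrArg (fun S : E →L[ℝ] E => S z) h
  -- `L` has to be defined on all real operators, including those whose transfer to `ℂ⁴` is not
  -- complex linear. Any linear left inverse of the restriction of scalars serves, since only its
  -- values on complex linear operators matter.
  obtain ⟨R', hR'⟩ := R.exists_leftInverse_of_injective (LinearMap.ker_eq_bot.2 hR)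
  -- Composing the bivector `a ∧ cplx v a` with `-cplx v` yields the orthogonal projection onto the
  -- complex line of `a`.
  let C : (R8 →L[ℝ] R8) →ₗ[ℝ] (E →L[ℝ] E) := sandwich (-(θ₁ ∘L cplx v)) θ₂
  let C' : (E →L[ℝ] E) →ₗ[ℝ] (R8 →L[ℝ] R8) := sandwich (cplx v ∘L θ₂) θ₁
  have hCC (x : R8 →L[ℝ] R8) : C' (C x) = x := by
    refine ContinuousLinearMap.ext fun a => ?_
    change cplx v (θ₂ (-θ₁ (cplx v (x (θ₂ (θ₁ a)))))) = x a
    rw [h21, map_neg, h21, map_neg, cplx_cplx_of_unit hv.2 (S6_inner_self hv), neg_neg]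
  have hP (a : R8) (ha : ⟪a, a⟫_ℝ = 1) :
      C (wedge a (cplx v a)) = R ((Submodule.span ℂ {θ a}).starProjection) := by
    have hn : ‖θ a‖ = 1 := by
      rw [θ.norm_map, ← sq_eq_sq₀ (norm_nonneg _) zero_le_one, ← real_inner_self_eq_norm_sq, ha,
        one_pow]
    refine ContinuousLinearMap.ext fun z => ?_
    obtain ⟨b, rfl⟩ := θ.surjective z
    change -θ (cplx v (wedge a (cplx v a) (θ₂ (θ₁ b)))) =
      (Submodule.span ℂ {θ a}).starProjection (θ b)
    rw [h21, ← map_neg, Submodule.starProjection_unit_singleton ℂ hn, inner_complex_isometry hθ]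
    have h1 : -(cplx v (wedge a (cplx v a) b)) = ⟪a, b⟫_ℝ • a + ⟪cplx v a, b⟫_ℝ • cplx v a := by
      simp only [wedge, sub_apply, ContinuousLinearMap.smulRight_apply, innerSL_apply_apply,
        map_sub, map_smul, cplx_cplx_of_unit hv.2 (S6_inner_self hv)]
      module
    have h2 : (⟨⟪a, b⟫_ℝ, ⟪cplx v a, b⟫_ℝ⟩ : ℂ) =
        (⟪a, b⟫_ℝ : ℂ) + (⟪cplx v a, b⟫_ℝ : ℂ) * Complex.I := by
      apply Complex.ext <;> simp
    rw [h1, h2, map_add, map_smul, map_smul, hθ, add_smul, mul_smul]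
    rfl
  have hL (a : R8) (ha : ⟪a, a⟫_ℝ = 1) :
      R' (C (wedge a (cplx v a))) = (Submodule.span ℂ {θ a}).starProjection := by
    rw [hP a ha]
    exact LinearMap.congr_fun hR' _
  refine ⟨LinearMap.toContinuousLinearMap (R' ∘ₗ C), LinearMap.toContinuousLinearMap (C' ∘ₗ R),
    fun a ha => ⟨?_, ?_⟩, ?_⟩
  · have h0 : θ a ≠ 0 := by
      intro h
      rw [θ.map_eq_zero_iff] at h
      simp [h] at ha
    refine ⟨Projectivization.mk ℂ (θ a) h0, ?_⟩
    change _ = R' (C (wedge a (cplx v a)))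
    rw [hL a ha]
    simp only [Projectivization.submodule_mk]
  · change C' (R (R' (C (wedge a (cplx v a))))) = _
    rw [hL a ha, ← hP a ha, hCC]
  · rintro _ ⟨l, rfl⟩
    have hn : ‖l.rep‖ ≠ 0 := norm_ne_zero_iff.2 l.rep_nonzero
    refine ⟨θ.symm ((‖l.rep‖⁻¹ : ℂ) • l.rep), ?_, ?_⟩
    · rw [real_inner_self_eq_norm_sq, θ.symm.norm_map, norm_smul]
      simp [hn]
    · change _ = R' (C (wedge _ (cplx v _)))
      have hunit : IsUnit ((‖l.rep‖ : ℂ)⁻¹) :=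
        (inv_ne_zero (Complex.ofReal_ne_zero.2 hn)).isUnit
      rw [hL, θ.apply_symm_apply]
      · simp only [Projectivization.submodule_eq, Submodule.span_singleton_smul_eq hunit]
      · rw [real_inner_self_eq_norm_sq, θ.symm.norm_map, norm_smul]
        simp [hn]

/-! ### Local triviality of `τ` -/

/-- The operator `1 - cplx m ∘ cplx v`, which intertwines `cplx v` and `cplx m`. -/
def transport (m v : R8) : R8 →L[ℝ] R8 := ContinuousLinearMap.id ℝ R8 - cplx m ∘L cplx v

lemma transport_apply (m v a : R8) : transport m v a = a - cplx m (cplx v a) := rfl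

variable {m v : R8}

/-- By `inner_transport` the two operators are adjoint, so `transport m v` is a multiple of an
isometry; on `S⁶` the factor vanishes only for `v = -m`. -/
lemma transport_transport (hm : m ∈ S6) (hv : v ∈ S6) (a : R8) :
    transport v m (transport m v a) = (2 * (1 + ⟪m, v⟫_ℝ)) • a := by
  have h1 := cplx_add_swap hm.2 hv.2 a
  rw [transport_apply, transport_apply, map_sub, map_sub,
    cplx_cplx_of_unit hm.2 (S6_inner_self hm), map_neg, cplx_cplx_of_unit hv.2 (S6_inner_self hv),
    neg_neg, eq_sub_of_add_eq h1]
  module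

lemma transport_cplx (hm : m ∈ S6) (hv : v ∈ S6) (a : R8) :
    transport m v (cplx v a) = cplx m (transport m v a) := by
  rw [transport_apply, transport_apply, map_sub, cplx_cplx_of_unit hm.2 (S6_inner_self hm),
    cplx_cplx_of_unit hv.2 (S6_inner_self hv), map_neg]
  abel

lemma inner_transport (hm : m ∈ S6) (hv : v ∈ S6) (a b : R8) :
    ⟪transport m v a, b⟫_ℝ = ⟪a, transport v m b⟫_ℝ := by
  rw [transport_apply, transport_apply, inner_sub_left, inner_sub_right, inner_cplx_swap hm.2,
    inner_cplx_swap hv.2, neg_neg]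

lemma exists_transport_wedge (hm : m ∈ S6) (hv : v ∈ S6) (h : 0 < 1 + ⟪m, v⟫_ℝ) {a : R8}
    (ha : ⟪a, a⟫_ℝ = 1) : ∃ b : R8, ⟪b, b⟫_ℝ = 1 ∧
      (2 * (1 + ⟪m, v⟫_ℝ))⁻¹ • (transport m v ∘L wedge a (cplx v a) ∘L transport v m) =
        wedge b (cplx m b) := by
  set c := 2 * (1 + ⟪m, v⟫_ℝ) with hc
  have hc0 : 0 < c := by positivity
  have hs : (√c)⁻¹ * (√c)⁻¹ = c⁻¹ := by rw [← mul_inv, Real.mul_self_sqrt hc0.le]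
  -- The normalized image of `a`; a bivector is quadratic in it, so the square roots combine to
  -- `c⁻¹`.
  refine ⟨(√c)⁻¹ • transport m v a, ?_, ?_⟩
  · rw [inner_smul_left, inner_smul_right, conj_trivial, ← mul_assoc, hs, inner_transport hm hv,
      transport_transport hm hv, inner_smul_right, ha, mul_one, inv_mul_cancel₀ hc0.ne']
  · refine ContinuousLinearMap.ext fun w => ?_
    simp only [wedge, sub_apply, smul_apply, ContinuousLinearMap.comp_apply, map_sub, map_smul,
      ContinuousLinearMap.smulRight_apply, innerSL_apply_apply, transport_cplx hm hv,
      ← inner_transport hm hv, smul_sub, smul_smul, ← hs]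
    congr 2 <;> ring

/-! ### Smoothness -/

lemma contDiff_spinLin : ContDiff ℝ ∞ fun x => spinLin x :=
  (LinearMap.toContinuousLinearMap spinLin).contDiff

lemma contDiff_spinInv : ContDiff ℝ ∞ fun x => spinInv x :=
  (LinearMap.toContinuousLinearMap spinInv).contDiff

lemma ContDiff.wedge {V : Type*} [NormedAddCommGroup V] [NormedSpace ℝ V] {f g : V → R8}
    (hf : ContDiff ℝ ∞ f) (hg : ContDiff ℝ ∞ g) : ContDiff ℝ ∞ fun x => wedge (f x) (g x) :=
  (((innerSL ℝ).contDiff.comp hf).smulRight hg).sub (((innerSL ℝ).contDiff.comp hg).smulRight hf)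

lemma contDiff_wedge : ContDiff ℝ ∞ fun v => wedge v (ebar 0) :=
  ContDiff.wedge contDiff_id contDiff_const

lemma contDiffOn_tau : ContDiffOn ℝ ∞ tau G28 :=
  ((contDiff_spinLin.clm_apply contDiff_const).neg.contDiffOn).congr fun _ hx => tau_eq hx

lemma contDiff_transport_right (m : R8) : ContDiff ℝ ∞ fun v => transport m v :=
  contDiff_const.sub (contDiff_const.clm_comp cplx.contDiff)

lemma contDiff_transport_left (m : R8) : ContDiff ℝ ∞ fun v => transport v m :=
  contDiff_const.sub (cplx.contDiff.clm_comp contDiff_const)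

/-! ### The fibre bundle -/

/-- Conjugation with the normalized `transport m v`. It identifies the fibre of `τ` over `v` with
the one over `m`. -/
def transportConj (m v : R8) (x : R8 →L[ℝ] R8) : R8 →L[ℝ] R8 :=
  (2 * (1 + ⟪m, v⟫_ℝ))⁻¹ • (transport m v ∘L x ∘L transport v m)

lemma transportConj_transportConj {m v : R8} (hm : m ∈ S6) (hv : v ∈ S6) (h : 0 < 1 + ⟪m, v⟫_ℝ)
    (x : R8 →L[ℝ] R8) : transportConj v m (transportConj m v x) = x := by
  have h0 : (2 * (1 + ⟪m, v⟫_ℝ)) ≠ 0 := (mul_pos two_pos h).ne'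
  refine ContinuousLinearMap.ext fun w => ?_
  rw [transportConj, transportConj, real_inner_comm m v]
  generalize hc : 2 * (1 + ⟪m, v⟫_ℝ) = c at h0
  simp only [smul_apply, ContinuousLinearMap.comp_apply, map_smul, transport_transport hm hv, hc,
    smul_smul]
  rw [show c⁻¹ * (c⁻¹ * c * c) = 1 by field_simp, one_smul]

lemma exists_transportConj_eq {m : R8} (hm : m ∈ S6) {x : R8 →L[ℝ] R8} (hx : x ∈ G28)
    (h : 0 < 1 + ⟪m, tau x⟫_ℝ) :
    ∃ b : R8, ⟪b, b⟫_ℝ = 1 ∧ transportConj m (tau x) x = wedge b (cplx m b) := by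
  obtain ⟨a, ha, hxa⟩ := (mem_fibre_iff (tau_mem_S6 hx) x).1 ⟨hx, rfl⟩
  obtain ⟨b, hb, h⟩ := exists_transport_wedge hm (tau_mem_S6 hx) h ha
  rw [← hxa] at h
  exact ⟨b, hb, h⟩

lemma transportConj_mem_fibre {m v : R8} (hm : m ∈ S6) (hv : v ∈ S6) (h : 0 < 1 + ⟪m, v⟫_ℝ)
    {a : R8} (ha : ⟪a, a⟫_ℝ = 1) :
    transportConj v m (wedge a (cplx m a)) ∈ G28 ∧
      tau (transportConj v m (wedge a (cplx m a))) = v := by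
  obtain ⟨b, hb, h⟩ := exists_transport_wedge hv hm (by rwa [real_inner_comm]) ha
  exact (mem_fibre_iff hv _).2 ⟨b, hb, h⟩

lemma contDiffOn_inv_inner (m : R8) :
    ContDiffOn ℝ ∞ (fun v => (2 * (1 + ⟪m, v⟫_ℝ))⁻¹) {v | 0 < 1 + ⟪m, v⟫_ℝ} := by
  refine ContDiffOn.inv ?_ fun v hv => ?_
  · exact (contDiff_const.mul (contDiff_const.add
      (contDiff_const.inner ℝ contDiff_id))).contDiffOn
  · have : 0 < 1 + ⟪m, v⟫_ℝ := hv
    positivity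

lemma ContDiffOn.transportConj_right {V : Type*} [NormedAddCommGroup V] [NormedSpace ℝ V]
    {s : Set V} {f : V → R8} {g : V → (R8 →L[ℝ] R8)} {m : R8} (hf : ContDiffOn ℝ ∞ f s)
    (hg : ContDiffOn ℝ ∞ g s) (h : ∀ x ∈ s, 0 < 1 + ⟪m, f x⟫_ℝ) :
    ContDiffOn ℝ ∞ (fun x => transportConj m (f x) (g x)) s :=
  ((contDiffOn_inv_inner m).comp hf h).smul (((contDiff_transport_right m).comp_contDiffOn
    hf).clm_comp (hg.clm_comp ((contDiff_transport_left m).comp_contDiffOn hf)))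

lemma ContDiffOn.transportConj_left {V : Type*} [NormedAddCommGroup V] [NormedSpace ℝ V]
    {s : Set V} {f : V → R8} {g : V → (R8 →L[ℝ] R8)} {m : R8} (hf : ContDiffOn ℝ ∞ f s)
    (hg : ContDiffOn ℝ ∞ g s) (h : ∀ x ∈ s, 0 < 1 + ⟪m, f x⟫_ℝ) :
    ContDiffOn ℝ ∞ (fun x => transportConj (f x) m (g x)) s := by
  simp only [transportConj, real_inner_comm m]
  exact ((contDiffOn_inv_inner m).comp hf h).smul (((contDiff_transport_left m).comp_contDiffOn
    hf).clm_comp (hg.clm_comp ((contDiff_transport_right m).comp_contDiffOn hf)))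

/-- Over the points of `S⁶` other than `-m`, the fibre over `v` is carried to the fibre over `m` and
then into `F` by the linear model `L`. On that one fibre `L'` undoes `L`, which suffices because
every plane is transported there first. -/
lemma isSmoothFibreBundle_of_fibre_model {U : Type*} [NormedAddCommGroup U] [NormedSpace ℝ U]
    {F : Set U} (hF : ∀ m ∈ S6, ∃ (L : (R8 →L[ℝ] R8) →L[ℝ] U) (L' : U →L[ℝ] (R8 →L[ℝ] R8)),
      (∀ a : R8, ⟪a, a⟫_ℝ = 1 → L (wedge a (cplx m a)) ∈ F ∧
        L' (L (wedge a (cplx m a))) = wedge a (cplx m a)) ∧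
      ∀ P ∈ F, ∃ a : R8, ⟪a, a⟫_ℝ = 1 ∧ P = L (wedge a (cplx m a))) :
    IsSmoothFibreBundle tau G28 S6 F := by
  refine ⟨fun x hx => tau_mem_S6 hx, contDiffOn_tau, fun m hm => ?_⟩
  obtain ⟨L, L', hL, hL'⟩ := hF m hm
  have hmO : 0 < 1 + ⟪m, m⟫_ℝ := by
    rw [S6_inner_self hm]
    norm_num
  let e : PartialEquiv (R8 →L[ℝ] R8) (R8 × U) :=
    { toFun := fun x => (tau x, L (transportConj m (tau x) x))
      invFun := fun p => transportConj p.1 m (L' p.2)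
      source := G28 ∩ tau ⁻¹' {v | 0 < 1 + ⟪m, v⟫_ℝ}
      target := (S6 ∩ {v | 0 < 1 + ⟪m, v⟫_ℝ}) ×ˢ F
      map_source' := by
        rintro x ⟨hx, hxO⟩
        obtain ⟨b, hb, h⟩ := exists_transportConj_eq hm hx hxO
        exact ⟨⟨tau_mem_S6 hx, hxO⟩, h ▸ (hL b hb).1⟩
      map_target' := by
        rintro ⟨v, P⟩ ⟨⟨hv, hvO⟩, hP⟩
        obtain ⟨a, ha, rfl⟩ := hL' P hP
        obtain ⟨h1, h2⟩ := transportConj_mem_fibre hm hv hvO ha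
        simp only [(hL a ha).2]
        exact ⟨h1, by rw [Set.mem_preimage, h2]; exact hvO⟩
      left_inv' := by
        rintro x ⟨hx, hxO⟩
        obtain ⟨b, hb, h⟩ := exists_transportConj_eq hm hx hxO
        have h1 : L' (L (transportConj m (tau x) x)) = transportConj m (tau x) x := by
          rw [h, (hL b hb).2]
        simp only [h1]
        exact transportConj_transportConj hm (tau_mem_S6 hx) hxO x
      right_inv' := by
        rintro ⟨v, P⟩ ⟨⟨hv, hvO⟩, hP⟩
        obtain ⟨a, ha, rfl⟩ := hL' P hP
        have h2 := (transportConj_mem_fibre hm hv hvO ha).2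
        have hvO' : 0 < 1 + ⟪v, m⟫_ℝ := by rw [real_inner_comm]; exact hvO
        simp only [(hL a ha).2, h2, transportConj_transportConj hv hm hvO'] }
  refine ⟨{v | 0 < 1 + ⟪m, v⟫_ℝ}, isOpen_lt continuous_const (by fun_prop), hmO, e,
    ⟨rfl, rfl, ?_, ?_⟩, fun x _ => rfl⟩
  · have hτ : ContDiffOn ℝ ∞ tau (G28 ∩ tau ⁻¹' {v | 0 < 1 + ⟪m, v⟫_ℝ}) :=
      contDiffOn_tau.mono Set.inter_subset_left
    exact hτ.prodMk (L.contDiff.comp_contDiffOn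
      (ContDiffOn.transportConj_right hτ contDiffOn_id fun x hx => hx.2))
  · exact ContDiffOn.transportConj_left contDiff_fst.contDiffOn
      (L'.contDiff.comp contDiff_snd).contDiffOn fun p hp => hp.1.2

lemma isSmoothFibreBundle_tau : IsSmoothFibreBundle tau G28 S6 CP3 :=
  isSmoothFibreBundle_of_fibre_model fun _ hm => exists_fibre_model hm

/-! ### The twistor space -/

lemma onTangent_mem_complexStructures {x : R8 →L[ℝ] R8} (hx : x ∈ G28) :
    onTangent (tau x) (spinLin x) ∈ complexStructures (tau x) :=
  ⟨isOrthogonalComplexStructure_onTangent hx, inducesOrientation_onTangent hx⟩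

/-- The alternative `-j` in `exists_plane` is excluded: structures of planes are oriented, and `j`
and `-j` cannot both be. -/
lemma exists_plane_of_mem_complexStructures {v : R8} (hv : v ∈ S6)
    {j : tangent v →L[ℝ] tangent v} (hj : j ∈ complexStructures v) :
    ∃ x ∈ G28, tau x = v ∧ onTangent v (spinLin x) = j := by
  obtain ⟨x, hx, rfl, h | h⟩ := hj.1.exists_plane hv
  · exact ⟨x, hx, rfl, h⟩
  · exact absurd (h ▸ inducesOrientation_onTangent hx) (hj.2.not_neg hv hj.1)

lemma bijOn_onTangent {v : R8} (hv : v ∈ S6) :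
    Set.BijOn (fun x => onTangent v (spinOp x)) (G28 ∩ tau ⁻¹' {v}) (complexStructures v) := by
  simp only [spinOp_eq]
  refine ⟨?_, ?_, ?_⟩
  · rintro x ⟨hx, rfl⟩
    exact onTangent_mem_complexStructures hx
  · rintro x ⟨hx, rfl⟩ y ⟨hy, hxy⟩ h
    have hxy : tau y = tau x := hxy
    have h : onTangent (tau x) (spinLin x) = onTangent (tau x) (spinLin y) := h
    have h2 := eq_spinInv hy
    rw [hxy, ← h] at h2
    rw [eq_spinInv hx, ← h2]
  · intro j hj
    obtain ⟨x, hx, hxv, h⟩ := exists_plane_of_mem_complexStructures hv hj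
    exact ⟨x, ⟨hx, hxv⟩, h⟩

lemma exists_diffeomorphism_twistorSpace :
    ∃ e : PartialEquiv (R8 →L[ℝ] R8) (R8 × (R8 →L[ℝ] R8)),
      IsDiffeomorphism e G28 twistorSpace ∧
      ∀ x ∈ G28, e x = (tau x, extend (onTangent (tau x) (spinOp x))) := by
  simp only [spinOp_eq]
  have hex {p : R8 × (R8 →L[ℝ] R8)} (hp : p ∈ twistorSpace) :
      ∃ x ∈ G28, p = (tau x, extend (onTangent (tau x) (spinLin x))) := by
    obtain ⟨v, T⟩ := p
    obtain ⟨hv, j, hj, hT⟩ := hp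
    have hv : v ∈ S6 := hv
    have hT : T = extend j := hT
    obtain ⟨x, hx, rfl, rfl⟩ := exists_plane_of_mem_complexStructures hv hj
    exact ⟨x, hx, Prod.ext rfl hT⟩
  let e : PartialEquiv (R8 →L[ℝ] R8) (R8 × (R8 →L[ℝ] R8)) :=
    { toFun := fun x => (tau x, extend (onTangent (tau x) (spinLin x)))
      -- Adding the rotation in the plane of `ebar 0` and `v` restores the operator on `ℝ⁸`, and
      -- `spinInv` recovers the bivector.
      invFun := fun p => spinInv (p.2 + wedge p.1 (ebar 0))
      source := G28
      target := twistorSpace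
      map_source' := fun x hx => ⟨tau_mem_S6 hx, _, onTangent_mem_complexStructures hx, rfl⟩
      map_target' := fun p hp => by
        obtain ⟨x, hx, rfl⟩ := hex hp
        rw [← eq_spinInv hx]
        exact hx
      left_inv' := fun x hx => (eq_spinInv hx).symm
      right_inv' := fun p hp => by
        obtain ⟨x, hx, rfl⟩ := hex hp
        have h := eq_spinInv hx
        change (_, extend (onTangent _ _)) = _
        rw [← h] }
  refine ⟨e, ⟨rfl, rfl, ?_, ?_⟩, fun x _ => rfl⟩
  · refine contDiffOn_tau.prodMk (ContDiffOn.congr ?_ fun x hx => extend_onTangent hx)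
    exact contDiff_spinLin.contDiffOn.sub (contDiff_wedge.comp_contDiffOn contDiffOn_tau)
  · exact (contDiff_spinInv.comp (contDiff_snd.add (contDiff_wedge.comp contDiff_fst))).contDiffOn

/-! ### Almost complex structures on the sphere -/

lemma extend_onTangent_of_tau_eq {x : R8 →L[ℝ] R8} (hx : x ∈ G28) {v : R8} (hv : tau x = v) :
    extend (onTangent v (spinLin x)) = spinLin x - wedge v (ebar 0) := by
  subst hv
  exact extend_onTangent hx

lemma inducedStructure_eq (f : R8 → (R8 →L[ℝ] R8)) (v : R8) :
    inducedStructure f v = onTangent v (spinLin (f v)) := by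
  rw [inducedStructure, spinOp_eq]

lemma IsSection.inducedStructure_mem {f : R8 → (R8 →L[ℝ] R8)} (hf : IsSection f) {v : R8}
    (hv : v ∈ S6) : inducedStructure f v ∈ complexStructures v := by
  obtain ⟨hx, hτ⟩ := hf.2 v hv
  exact (bijOn_onTangent hv).mapsTo ⟨hx, hτ⟩

lemma IsSection.isAlmostComplexStructure {f : R8 → (R8 →L[ℝ] R8)} (hf : IsSection f) :
    IsAlmostComplexStructure (inducedStructure f) := by
  refine ⟨?_, fun v hv => (hf.inducedStructure_mem hv).1⟩
  refine ContDiffOn.congr (f := fun v => spinLin (f v) - wedge v (ebar 0)) ?_ fun v hv => ?_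
  · exact (contDiff_spinLin.comp_contDiffOn hf.1).sub contDiff_wedge.contDiffOn
  · rw [inducedStructure_eq]
    exact extend_onTangent_of_tau_eq (hf.2 v hv).1 (hf.2 v hv).2

lemma IsAlmostComplexStructure.exists_section {J : ∀ v : R8, tangent v →L[ℝ] tangent v}
    (hJ : IsAlmostComplexStructure J) (ho : ∀ v ∈ S6, InducesOrientation (J v)) :
    ∃ f : R8 → (R8 →L[ℝ] R8), (IsSection f ∧ ∀ v ∈ S6, inducedStructure f v = J v) ∧
      ∀ f' : R8 → (R8 →L[ℝ] R8),
        IsSection f' ∧ (∀ v ∈ S6, inducedStructure f' v = J v) → Set.EqOn f' f S6 := by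
  let f : R8 → (R8 →L[ℝ] R8) := fun v => spinInv (extend (J v) + wedge v (ebar 0))
  have hf {v : R8} (hv : v ∈ S6) :
      f v ∈ G28 ∧ tau (f v) = v ∧ onTangent v (spinLin (f v)) = J v := by
    obtain ⟨x, hx, rfl, h⟩ := exists_plane_of_mem_complexStructures hv ⟨hJ.2 v hv, ho v hv⟩
    have hxf : f (tau x) = x := by
      simp only [f, ← h]
      exact (eq_spinInv hx).symm
    rw [hxf]
    exact ⟨hx, rfl, h⟩
  refine ⟨f, ⟨⟨?_, fun v hv => ⟨(hf hv).1, (hf hv).2.1⟩⟩, fun v hv => ?_⟩, ?_⟩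
  · exact contDiff_spinInv.comp_contDiffOn (hJ.1.add contDiff_wedge.contDiffOn)
  · rw [inducedStructure_eq, (hf hv).2.2]
  · rintro f' ⟨hf', hJ'⟩ v hv
    refine (bijOn_onTangent hv).injOn (hf'.2 v hv) ⟨(hf hv).1, (hf hv).2.1⟩ ?_
    change inducedStructure f' v = inducedStructure f v
    rw [hJ' v hv, inducedStructure_eq, (hf hv).2.2]

/-! ### Constancy of the orientation over the sphere. -/

lemma isCompact_G28 : IsCompact G28 := by
  have h1 : G28 = (fun p : R8 × R8 => wedge p.1 p.2) ''
      ((Metric.sphere 0 1 ×ˢ Metric.sphere 0 1) ∩ {p | ⟪p.1, p.2⟫_ℝ = 0}) := by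
    have hn (a : R8) : ⟪a, a⟫_ℝ = 1 ↔ ‖a‖ = 1 := by
      rw [real_inner_self_eq_norm_sq, pow_eq_one_iff_of_nonneg (norm_nonneg a) two_ne_zero]
    ext x
    simp only [G28, orthonormal_pair_iff, hn, Set.mem_ofPred_eq, Set.mem_image, Set.mem_inter_iff,
      Set.mem_prod, mem_sphere_zero_iff_norm, Prod.exists]
    constructor
    · rintro ⟨a, b, ⟨ha, hb, hab⟩, rfl⟩
      exact ⟨a, b, ⟨⟨ha, hb⟩, hab⟩, rfl⟩
    · rintro ⟨a, b, ⟨⟨ha, hb⟩, hab⟩, rfl⟩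
      exact ⟨a, b, ⟨ha, hb, hab⟩, rfl⟩
  rw [h1]
  refine IsCompact.image ?_ (ContDiff.wedge contDiff_fst contDiff_snd).continuous
  exact ((isCompact_sphere _ _).prod (isCompact_sphere _ _)).inter_right
    (isClosed_eq (continuous_fst.inner continuous_snd) continuous_const)

lemma isClosed_S6 : IsClosed S6 :=
  (isClosed_eq continuous_norm continuous_const).inter
    (isClosed_eq (continuous_const.inner continuous_id) continuous_const)

lemma isPreconnected_S6 : IsPreconnected S6 := by
  let W : Submodule ℝ R8 := (Submodule.span ℝ {ebar 0})ᗮ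
  have hrank : 1 < Module.rank ℝ W := by
    have : Fact (Module.finrank ℝ R8 = 7 + 1) := ⟨by simp⟩
    have h0 : ebar 0 ≠ 0 := fun h => by simpa [h] using norm_ebar 0
    have h7 : Module.finrank ℝ W = 7 := Submodule.finrank_orthogonal_span_singleton h0
    exact Module.lt_rank_of_lt_finrank (by rw [h7]; norm_num)
  have h1 := (isPreconnected_sphere hrank 0 1).image ((↑) : W → R8)
    continuous_subtype_val.continuousOn
  convert h1 using 1
  ext v
  constructor
  · rintro ⟨hn, hv⟩
    exact ⟨⟨v, Submodule.mem_orthogonal_singleton_iff_inner_right.2 hv⟩, by simpa using hn, rfl⟩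
  · rintro ⟨w, hw, rfl⟩
    exact ⟨by simpa using hw, Submodule.mem_orthogonal_singleton_iff_inner_right.1 w.2⟩

/-- Being oriented becomes membership in the image of a compact set, hence a closed condition on `j`
and `v` together. -/
lemma inducesOrientation_iff {v : R8} (hv : v ∈ S6) {j : tangent v →L[ℝ] tangent v}
    (hj : IsOrthogonalComplexStructure j) :
    InducesOrientation j ↔ extend j + wedge v (ebar 0) ∈ (fun x => spinLin x) '' G28 := by
  constructor
  · intro h
    obtain ⟨x, hx, rfl, rfl⟩ := exists_plane_of_mem_complexStructures hv ⟨hj, h⟩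
    exact ⟨x, hx, by rw [extend_onTangent hx, sub_add_cancel]⟩
  · rintro ⟨x, hx, h⟩
    have h : spinLin x = extend j + wedge v (ebar 0) := h
    have hv0 : ⟪v, ebar 0⟫_ℝ = 0 := by rw [real_inner_comm]; exact hv.2
    have hτ : tau x = v := by
      rw [tau_eq hx, h, add_apply, extend_ebar_zero hv]
      simp [wedge, hv0, norm_ebar]
    subst hτ
    have h1 : onTangent (tau x) (spinLin x) = j :=
      extend_injective (by rw [extend_onTangent hx, h, add_sub_cancel_right])
    exact h1 ▸ inducesOrientation_onTangent hx

lemma IsAlmostComplexStructure.isClosed_inducesOrientation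
    {J : ∀ v : R8, tangent v →L[ℝ] tangent v} (hJ : IsAlmostComplexStructure J) :
    IsClosed {v | v ∈ S6 ∧ InducesOrientation (J v)} := by
  have hF : ContinuousOn (fun v => extend (J v) + wedge v (ebar 0)) S6 :=
    hJ.1.continuousOn.add contDiff_wedge.continuous.continuousOn
  have hK : IsClosed ((fun x => spinLin x) '' G28) :=
    (isCompact_G28.image contDiff_spinLin.continuous).isClosed
  convert hF.preimage_isClosed_of_isClosed isClosed_S6 hK using 1
  ext v
  exact and_congr_right fun hv => inducesOrientation_iff hv (hJ.2 v hv)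

lemma IsAlmostComplexStructure.neg {J : ∀ v : R8, tangent v →L[ℝ] tangent v}
    (hJ : IsAlmostComplexStructure J) : IsAlmostComplexStructure fun v => -J v := by
  refine ⟨hJ.1.neg.congr fun v _ => ?_, fun v hv => ⟨fun w => ?_, fun w w' => ?_⟩⟩
  · refine ContinuousLinearMap.ext fun w => ?_
    simp [extend_apply]
  · simp [(hJ.2 v hv).1]
  · simp [(hJ.2 v hv).2]

/-- The sets where `J` and where `-J` induces the orientation are closed, disjoint and cover the
connected `S⁶`, so one of them is empty. -/
lemma IsAlmostComplexStructure.inducesOrientation_or_neg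
    {J : ∀ v : R8, tangent v →L[ℝ] tangent v} (hJ : IsAlmostComplexStructure J) :
    (∀ v ∈ S6, InducesOrientation (J v)) ∨ ∀ v ∈ S6, InducesOrientation (-J v) := by
  have hor (v : R8) (hv : v ∈ S6) : InducesOrientation (J v) ∨ InducesOrientation (-J v) := by
    obtain ⟨x, hx, rfl, h | h⟩ := (hJ.2 v hv).exists_plane hv
    · exact Or.inl (h ▸ inducesOrientation_onTangent hx)
    · exact Or.inr (h ▸ inducesOrientation_onTangent hx)
  by_contra! hcon
  obtain ⟨⟨v, hv, hvJ⟩, w, hw, hwJ⟩ := hcon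
  obtain ⟨u, hu, hu1, hu2⟩ := isPreconnected_closed_iff.1 isPreconnected_S6 _ _
    hJ.isClosed_inducesOrientation hJ.neg.isClosed_inducesOrientation
    (fun v hv => (hor v hv).imp (fun h => ⟨hv, h⟩) fun h => ⟨hv, h⟩)
    ⟨w, hw, hw, (hor w hw).resolve_right hwJ⟩ ⟨v, hv, hv, (hor v hv).resolve_left hvJ⟩
  exact hu1.2.not_neg hu (hJ.2 u hu) hu2.2

end SixSphereTwistor

end

theorem theorem2p2 :
    -- the equations that define `Φ^*` and `τ` on `G(2,8)` have exactly one solution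
    (∀ x ∈ G28, (∃! B : Matrix (Fin 8) (Fin 8) ℝ, IsSpinMatrix x B) ∧
      ∃! v : R8, v ∈ S6 ∧ toCl x * spinorA = vec (ebar 0) * vec v * spinorA) ∧
    -- `τ` is a fibre bundle over the sphere, with fibre `CP³`
    IsSmoothFibreBundle tau G28 S6 CP3 ∧
    -- `Φ^*` maps the fibre over `v` bijectively onto the complex structures on `T_v S⁶`
    (∀ v ∈ S6,
      (∀ x ∈ G28, tau x = v → ∀ w ∈ tangent v, spinOp x w ∈ tangent v) ∧
      Set.BijOn (fun x => onTangent v (spinOp x)) (G28 ∩ tau ⁻¹' {v}) (complexStructures v)) ∧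
    -- `G(2,8)` is the twistor space
    (∃ e : PartialEquiv (R8 →L[ℝ] R8) (R8 × (R8 →L[ℝ] R8)),
      IsDiffeomorphism e G28 twistorSpace ∧
      ∀ x ∈ G28, e x = (tau x, extend (onTangent (tau x) (spinOp x)))) ∧
    -- sections of `τ` define oriented almost complex structures
    (∀ f : R8 → (R8 →L[ℝ] R8), IsSection f →
      IsAlmostComplexStructure (inducedStructure f) ∧
      ∀ v ∈ S6, InducesOrientation (inducedStructure f v)) ∧
    -- each oriented almost complex structure is defined by exactly one section
    (∀ J : ∀ v : R8, tangent v →L[ℝ] tangent v, IsAlmostComplexStructure J →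
      (∀ v ∈ S6, InducesOrientation (J v)) →
      ∃ f : R8 → (R8 →L[ℝ] R8), (IsSection f ∧ ∀ v ∈ S6, inducedStructure f v = J v) ∧
        ∀ f' : R8 → (R8 →L[ℝ] R8),
          IsSection f' ∧ (∀ v ∈ S6, inducedStructure f' v = J v) → Set.EqOn f' f S6) ∧
    -- every almost complex structure is oriented up to sign
    (∀ J : ∀ v : R8, tangent v →L[ℝ] tangent v, IsAlmostComplexStructure J →
      (∀ v ∈ S6, InducesOrientation (J v)) ∨ ∀ v ∈ S6, InducesOrientation (-J v)) := by
  refine ⟨fun x hx => ⟨existsUnique_isSpinMatrix x, existsUnique_tau (neg_spinLin_mem_S6 hx)⟩,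
    isSmoothFibreBundle_tau, fun v hv => ⟨fun x hx h w hw => ?_, bijOn_onTangent hv⟩,
    exists_diffeomorphism_twistorSpace,
    fun f hf => ⟨hf.isAlmostComplexStructure, fun v hv => (hf.inducedStructure_mem hv).2⟩,
    fun J hJ ho => hJ.exists_section ho, fun J hJ => hJ.inducesOrientation_or_neg⟩
  subst h
  rw [spinOp_eq]
  exact spinLin_mem_tangent hx hw
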